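/- A star edge-coloring of a graph $G$ is a proper edge-coloring of $G$ in which no path and no cycle with exactly four edges is colored with only two colors. The star chromatic index $\chi'_{\mathrm{st}}(G)$ is the minimum number of colors in a star edge-coloring of $G$. Let $C_n$ denote the cycle on $n$ vertices and let $\square$ denote the Cartesian product of graphs. Then for every integer $n \ge 3$, $$ \chi'_{\mathrm{st}}(C_6 \mathbin{\square} C_n) = \begin{cases} 6, & \text{if } n \equiv 0 \pmod 3 \text{ or } n \equiv 0 \pmod 4,\\ 7, & \text{otherwise.} \end{cases} $$ -/

import Mathlib

namespace SimpleGraph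

variable {V : Type*}

/-- A walk is bichromatic under an edge coloring `c` (given as a proper vertex coloring of the
line graph) if all its edges have one of two colors `a`, `b`. -/
def IsBichromatic {G : SimpleGraph V} {α : Type*} (c : G.lineGraph.Coloring α)
    {u v : V} (p : G.Walk u v) : Prop :=
  ∃ a b : α, ∀ e (he : e ∈ p.edges),
    c ⟨e, p.edges_subset_edgeSet he⟩ = a ∨ c ⟨e, p.edges_subset_edgeSet he⟩ = b

/-- A proper edge coloring, i.e. a proper vertex coloring of the line graph, is a star edge
coloring if no path and no cycle with four edges is bichromatic. -/
def IsStarEdgeColoring {G : SimpleGraph V} {α : Type*} (c : G.lineGraph.Coloring α) : Prop :=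
  (∀ (u v : V) (p : G.Walk u v), p.IsPath → p.length = 4 → ¬ IsBichromatic c p) ∧
  (∀ (u : V) (p : G.Walk u u), p.IsCycle → p.length = 4 → ¬ IsBichromatic c p)

/-- `G` admits a star edge coloring with (at most) `k` colors. -/
def StarEdgeColorable (G : SimpleGraph V) (k : ℕ) : Prop :=
  ∃ c : G.lineGraph.Coloring (Fin k), IsStarEdgeColoring c

/-- The star chromatic index: the least number of colors in a star edge coloring
(`⊤` if no finite number of colors suffices). -/
noncomputable def starChromaticIndex (G : SimpleGraph V) : ℕ∞ :=
  ⨅ k ∈ {k : ℕ | G.StarEdgeColorable k}, (k : ℕ∞)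

end SimpleGraph

/-! Everything reduces to colorings of the infinite strip, the product of a 6-cycle and a two-way
infinite path. An edge coloring of the torus lifts to a strip coloring with period `n` (`lift`), and
a periodic strip coloring descends (`starEdgeColorable_of_strip`). Since the coloring is proper, the
star condition is local: for two distinct edges `d`, `d'` at a vertex, it cannot happen that the
color of `d'` occurs at the far end of `d` and the color of `d` at the far end of `d'`.

Five colors never suffice (`Strip.exists_ge_five`). Each vertex misses only one color, each of the
six pairs of edges at a vertex needs a missing color at one of the four neighbors, and one neighbor
can serve only one pair.

With six colors the strip is rigid. `Strip.Valid.uniform` says that around every column a coloring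
looks like one of three kinds: every third column is distinguished by its horizontal edges, or
columns at distance 4 agree while those at distance 2 differ, or columns at distance 6 agree while
those at distance 2 differ. The kind is also the same at adjacent columns. By translation the kind
is constant along the strip, so a period `n` is divisible by 3, by 4, or by 3 respectively
(`Strip.Valid.dvd_of_periodic`).

Rigidity is a finite statement, proved by a backtracking search evaluated in the kernel. Up to
rotation, reflection and renaming of colors the centre column has nine colorings; each is extended
outwards with constraint propagation until a contradiction arises or the kinds can be read off. Only
soundness is verified (`search_sound`): the heuristic choosing the next edge needs no proof, and
propagation may be incomplete.

The upper bounds are explicit (`starEdgeColorable_of_table`): periodic tables for six colors, and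
for seven colors a loop of three columns combined with a detour of four or five. -/

namespace StarSearch

/-! ### A search procedure for the kernel

The definitions below are evaluated by kernel reduction only; they are written with recursors and
the accelerated operations on `Nat`. The state of the search is packed in two numbers `D` and `A`.
Byte `e` of `D` holds the possible colors of the edge `e`, byte `e` of `A` its color if it has been
chosen, and byte `v + 200` of `A` the colors known to occur at the vertex `v`. The lowest eight
bytes carry no information: they make the numbers distinguishable by their residue mod `2 ^ 64`. -/

/-- Conditional. -/
noncomputable def sel {α : Type} (b : Bool) (x y : α) : α :=
  Bool.rec (motive := fun _ => α) y x b

/-- `force n k` is `k n`; reducing it evaluates `n` first. -/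
noncomputable def force {α : Type} (n : Nat) (k : Nat → α) : α :=
  Nat.rec (motive := fun _ => α) (k 0) (fun m _ => k (Nat.succ m)) n

/-- Lists of pairs (edge, other endpoint). -/
inductive Nbs where
  | nil : Nbs
  | cons (q z : Nat) (l : Nbs) : Nbs

/-- Lists of numbers. -/
inductive NList where
  | nil : NList
  | cons (x : Nat) (l : NList) : NList

/-- Vertices are numbered by `6 * column + row`. -/
noncomputable def up (v : Nat) : Nat :=
  sel (Nat.beq (Nat.mod v 6) 5) (Nat.sub v 5) (Nat.succ v)

noncomputable def dn (v : Nat) : Nat :=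
  sel (Nat.beq (Nat.mod v 6) 0) (Nat.add v 5) (Nat.sub v 1)

noncomputable def fcons (q z : Nat) (l : Nbs) : Nbs :=
  force q fun q => force z fun z => Nbs.cons q z l

/-- The edge from `v` upwards is `2 * v`, the edge to the right is `2 * v + 1`. -/
noncomputable def nb (v : Nat) : Nbs :=
  fcons (Nat.mul 2 v) (up v) (fcons (Nat.mul 2 (dn v)) (dn v)
    (fcons (Nat.succ (Nat.mul 2 v)) (Nat.add v 6)
      (fcons (Nat.sub (Nat.mul 2 v) 11) (Nat.sub v 6) Nbs.nil)))

noncomputable def bit (k : Nat) : Nat := Nat.shiftLeft 1 k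

noncomputable def posE (e x : Nat) : Nat := Nat.add (Nat.mul 8 e) x

noncomputable def posV (v x : Nat) : Nat := Nat.add (Nat.mul 8 (Nat.add v 200)) x

noncomputable def fldE (a e : Nat) : Nat := Nat.land (Nat.shiftRight a (Nat.mul 8 e)) 63

noncomputable def fldV (a v : Nat) : Nat :=
  Nat.land (Nat.shiftRight a (Nat.mul 8 (Nat.add v 200))) 63

noncomputable def edgeMask (l : Nbs) : Nat :=
  Nbs.rec (motive := fun _ => Nat) 0 (fun q _ _ ih => Nat.lor (bit (Nat.mul 8 q)) ih) l

/-- Color `x` at all edges of `v`. -/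
noncomputable def veS (v x : Nat) : Nat := Nat.shiftLeft (edgeMask (nb v)) x

/-- Bitwise `a` without `b`, using only operations the kernel accelerates. -/
noncomputable def clear (a b : Nat) : Nat := Nat.xor a (Nat.land a b)

noncomputable def tb (a k : Nat) : Bool := Nat.beq (Nat.mod (Nat.shiftRight a k) 2) 1

noncomputable def filt (l : Nbs) (e : Nat) : Nbs → Nbs :=
  Nbs.rec (motive := fun _ => Nbs → Nbs) (fun acc => acc)
    (fun q z _ ih acc => sel (Nat.beq q e) (ih acc) (ih (Nbs.cons q z acc))) l

noncomputable def nbq (v e : Nat) : Nbs := filt (nb v) e Nbs.nil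

/-- The endpoints of an edge. -/
noncomputable def eu (e : Nat) : Nat := Nat.div e 2

noncomputable def ew (e : Nat) : Nat :=
  sel (Nat.beq (Nat.mod e 2) 0) (up (Nat.div e 2)) (Nat.add (Nat.div e 2) 6)

noncomputable def sideU (e : Nat) : Nbs := nbq (eu e) e

noncomputable def sideW (e : Nat) : Nbs := nbq (ew e) e

/-- The least element of a nonempty set of colors. -/
noncomputable def idx (y : Nat) : Nat :=
  sel (tb y 0) 0 (sel (tb y 1) 1 (sel (tb y 2) 2 (sel (tb y 3) 3 (sel (tb y 4) 4 5))))

noncomputable def farSet (A x : Nat) (l : Nbs) : Nat :=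
  Nbs.rec (motive := fun _ => Nat) 0 (fun p t _ ih => sel (tb A (posE p x)) (fldV A t) ih) l

noncomputable def farMask (A x k : Nat) (l : Nbs) : Nat :=
  Nbs.rec (motive := fun _ => Nat) 0 (fun p t _ ih => sel (tb A (posE p x)) (veS t k) ih) l

/-- The edge `uw` has color `x`, which occurs at the neighbor `z` of `u`. So the color of the
edge `q = uz` occurs neither at `w` nor at the other end of the edge of color `x` at `z`. -/
noncomputable def hit (A x w q z : Nat) (ih : Nat → Nat) (D y : Nat) : Nat :=
  sel (Nat.beq y 0)
    (ih (clear D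
      (Nat.shiftLeft (Nat.lor (fldV A w) (farSet A x (nbq z q))) (Nat.mul 8 q))))
    (ih (clear D (Nat.lor (veS w (idx y)) (farMask A x (idx y) (nbq z q)))))

noncomputable def hitStep (A h x w q z : Nat) (ih : Nat → Nat) (D : Nat) : Nat :=
  sel (tb h (posV z x)) (hit A x w q z ih D (fldE A q)) (ih D)

noncomputable def hits (A h x w : Nat) (l : Nbs) : Nat → Nat :=
  Nbs.rec (motive := fun _ => Nat → Nat) (fun D => D)
    (fun q z _ ih => hitStep A h x w q z ih) l

/-- The edge `uw` gets color `x`, and the edge `q = uz` has a color in `m` which occurs at `w`.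
So `x` does not occur at `z`. -/
noncomputable def meetStep (A m x q z : Nat) (ih : Nat → Nat) (D : Nat) : Nat :=
  sel (Nat.beq (Nat.land (fldE A q) m) 0) (ih D) (ih (clear D (veS z x)))

noncomputable def meets (A m x : Nat) (l : Nbs) : Nat → Nat :=
  Nbs.rec (motive := fun _ => Nat → Nat) (fun D => D)
    (fun q z _ ih => meetStep A m x q z ih) l

noncomputable def adjx (e x : Nat) : Nat :=
  Nat.lor (Nat.lor (veS (eu e) x) (veS (ew e) x)) (Nat.shiftLeft 63 (Nat.mul 8 e))

noncomputable def endMask (l : Nbs) (x : Nat) : Nat :=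
  Nbs.rec (motive := fun _ => Nat) 0 (fun _ z _ ih => Nat.lor (bit (posV z x)) ih) l

noncomputable def endsMask (e x : Nat) : Nat :=
  Nat.lor (endMask (sideU e) x) (endMask (sideW e) x)

/-- The constants only scatter values over the lowest 64 bits. The proof uses nothing about `salt`
and `salt'` except that they are below `2 ^ 64`. -/
noncomputable def salt (e x : Nat) : Nat :=
  Nat.mod (Nat.mul (Nat.succ (posE e x)) 210306068529402873165736369884012333109) 18446744073709551557

noncomputable def salt' (e x : Nat) : Nat :=
  Nat.mod (Nat.mul (Nat.succ (posE e x)) 323816303142973574500960818020005608469) 18446744073709551533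

noncomputable def propagateHits (A e x u w h D : Nat) : Nat :=
  sel (Nat.beq h 0) D (hits A h x w (sideU e) (hits A h x u (sideW e) D))

noncomputable def propagateMeets (A e x m D : Nat) : Nat :=
  sel (Nat.beq m 0) D (meets A m x (sideU e) (meets A m x (sideW e) D))

noncomputable def propagate (A e x D u w : Nat) : Nat :=
  propagateHits A e x u w (Nat.land A (endsMask e x))
    (propagateMeets A e x (Nat.land (fldV A u) (fldV A w)) D)

/-- The possible colors after the edge `e` got color `x`. -/
noncomputable def assignD (D A e x : Nat) : Nat :=
  Nat.xor (propagate A e x (Nat.lor (clear D (adjx e x)) (bit (posE e x))) (eu e) (ew e))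
    (salt e x)

/-- Bit 6 of the byte of `e`, above the six color bits, marks the edge as colored; `pick` reads this
bit. -/
noncomputable def assignMask (e x : Nat) : Nat :=
  Nat.lor (Nat.lor (bit (posE e x)) (bit (posE e 6)))
    (Nat.lor (bit (posV (eu e) x)) (bit (posV (ew e) x)))

noncomputable def assignA (A e x : Nat) : Nat :=
  Nat.xor (Nat.lor A (assignMask e x)) (salt' e x)

noncomputable def nextUsed (x used : Nat) : Nat := sel (Nat.beq x used) (Nat.succ used) used

/-! #### The choice of the next edge -/

noncomputable def lowBytes : Nat := 18446744073709551615

/-- The salted low 64 bits are ignored. -/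
noncomputable def isz (a : Nat) : Bool := Nat.beq (Nat.shiftRight a 64) 0

/-- The value 1 in each of the 120 bytes from byte 36 on, as `288 = 8 * 36`. -/
noncomputable def ones : Nat :=
  Nat.shiftLeft (Nat.div (Nat.sub (Nat.pow 256 120) 1) 255) 288

/-- All colors are possible at the edges `36, …, 155`. -/
noncomputable def full : Nat := Nat.mul 63 ones

noncomputable def guards : Nat := Nat.mul 64 ones

noncomputable def guardsLow : Nat := Nat.lor guards lowBytes

noncomputable def guardsHigh : Nat := Nat.shiftRight guards 64

/-- Marks at bit 6, the bit used for colored edges; `a = 0` selects the vertical and `a = 1` the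
horizontal edges. -/
noncomputable def column (a j : Nat) : Nat :=
  Nat.rec (motive := fun _ => Nat) 0 (fun i ih =>
    Nat.lor ih (bit (posE (Nat.add a (Nat.mul 2 (Nat.add (Nat.mul 6 j) i))) 6))) 6

noncomputable def ring (a j k : Nat) : Nat :=
  Nat.lor lowBytes (Nat.lor (column a j) (column a k))

noncomputable def fconsN (x : Nat) (l : NList) : NList := force x fun x => NList.cons x l

/-- The edges to be colored, by their distance from the column `8`. -/
noncomputable def rings : NList :=
  fconsN (ring 0 8 8) (fconsN (ring 1 7 8) (fconsN (ring 0 7 9) (fconsN (ring 1 6 9)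
    (fconsN (ring 0 6 10) (fconsN (ring 1 5 10) (fconsN (ring 0 5 11) (fconsN (ring 1 4 11)
      (fconsN (ring 0 4 12) (fconsN (ring 1 3 12) NList.nil)))))))))

noncomputable def allRings : Nat :=
  NList.rec (motive := fun _ => Nat) 0 (fun r _ ih => Nat.lor r ih) rings

noncomputable def lowPick (ih t : Nat) : Nat := sel (isz t) ih t

noncomputable def lowRing (m : Nat) : Nat :=
  NList.rec (motive := fun _ => Nat) m (fun r _ ih => lowPick ih (Nat.land m r)) rings

/-- The edge `e` with `2 ^ (8 * e + 6) % 1277 = r`. -/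
noncomputable def findRes (r : Nat) : Nat :=
  Nat.rec (motive := fun _ => Nat → Nat) (fun e => e)
    (fun _ ih e =>
      -- The powers `2 ^ (8 * e + 6)` for the 120 edges have distinct residues, since 2 is a
      -- primitive root mod 1277 and so `2 ^ 8` has order 319. This decodes the position of a single
      -- bit.
      sel (Nat.beq (Nat.mod (Nat.pow 2 (posE e 6)) 1277) r) e (ih (Nat.succ e))) 120 36

noncomputable def lowBit (t : Nat) : Nat := Nat.xor t (Nat.land t (Nat.sub t 1))

noncomputable def resOf (t : Nat) : Nat :=
  Nat.mod (Nat.shiftLeft (lowBit (Nat.shiftRight t 64)) 64) 1277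

noncomputable def edgeOf (t : Nat) (k : Nat → Bool) : Bool :=
  force (resOf t) fun r => force (findRes r) k

noncomputable def pickPair (U : Nat) (k : Nat → Bool) (c : Nat) : Bool :=
  edgeOf (lowRing (sel (isz c) U c)) k

/-- If no open edge has a single possible color, a second color is removed from every byte of `D1`
that is still nonzero. Open edges whose byte then vanishes have two possible colors. -/
noncomputable def pickSingle (U D1 nz : Nat) (k : Nat → Bool) (c : Nat) : Bool :=
  sel (isz c)
    (pickPair U k (clear U (Nat.land
      (Nat.add (Nat.land D1 (Nat.sub D1 (Nat.shiftRight (Nat.land nz guards) 6))) full)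
      guardsLow)))
    (edgeOf c k)

noncomputable def pickRest (U D1 : Nat) (k : Nat → Bool) (nz : Nat) : Bool :=
  pickSingle U D1 nz k (clear U nz)

/-- Adding 63 to a byte with values in `0, …, 63` sets bit 6 exactly when the byte is nonzero,
without a carry into the next byte. This tests all edges at once. -/
noncomputable def pickMin (U : Nat) (k : Nat → Bool) (D1 : Nat) : Bool :=
  pickRest U D1 k (Nat.land (Nat.add D1 full) guardsLow)

/-- The conjunction with `D - ones` deletes the lowest color of every edge. No borrow occurs because
this is reached only when every edge has a possible color. -/
noncomputable def pickOpen (D : Nat) (none : Bool) (k : Nat → Bool) (U : Nat) : Bool :=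
  sel (isz U) none (pickMin U k (Nat.land D (Nat.sub D ones)))

noncomputable def pickEmpty (D A : Nat) (none : Bool) (k : Nat → Bool) (nz : Nat) : Bool :=
  sel (Nat.beq (Nat.shiftRight nz 64) guardsHigh) (pickOpen D none k (clear allRings A))
    (edgeOf (Nat.xor guards nz) k)

/-- `k e` for an edge `e` with no possible color, or else an edge without a color and with few
possible colors; `none` if all edges have been colored. -/
noncomputable def pick (D A : Nat) (none : Bool) (k : Nat → Bool) : Bool :=
  pickEmpty D A none k (Nat.land (Nat.add D full) guardsLow)

/-! #### The search -/

/-- The colors in `y` up to the first unused color. -/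
noncomputable def colorsOf (y used : Nat) : NList :=
  Nat.rec (motive := fun _ => NList → NList) (fun acc => acc)
    (fun x ih acc =>
      ih (sel (sel (Nat.ble x used) (tb y x) false) (NList.cons x acc) acc)) 6 NList.nil

noncomputable def colorsOfForce (y used : Nat) : NList := force y fun y => colorsOf y used

noncomputable def enterUsed (ih : Nat → Nat → Nat → Bool) (used x D A : Nat) : Bool :=
  force (nextUsed x used) (ih D A)

noncomputable def enterA (ih : Nat → Nat → Nat → Bool) (A used e x D : Nat) : Bool :=
  force (assignA A e x) (enterUsed ih used x D)

noncomputable def enter (ih : Nat → Nat → Nat → Bool) (D A used e x : Nat) : Bool :=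
  force (assignD D A e x) (enterA ih A used e x)

noncomputable def expandColors (ih : Nat → Nat → Nat → Bool) (D A used e : Nat) (l : NList) :
    Bool :=
  NList.rec (motive := fun _ => Bool) true (fun x _ r => sel (enter ih D A used e x) r false) l

/-- Branching is justified only for edges in the range where `D` is meaningful. Testing this at run
time means that nothing has to be proved about the edge returned by `pick`. -/
noncomputable def inWindow (e : Nat) : Bool := sel (Nat.ble 36 e) (Nat.ble e 155) false

noncomputable def expand (ih : Nat → Nat → Nat → Bool) (D A used e : Nat) : Bool :=
  sel (inWindow e) (expandColors ih D A used e (colorsOfForce (fldE D e) used)) false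

/-- `search leaf fuel D A used = true` if `leaf` holds for all colorings reached. -/
noncomputable def search (leaf : Nat → Bool) (fuel : Nat) : Nat → Nat → Nat → Bool :=
  -- Exhausted fuel yields `false`, so the amount of fuel is irrelevant to soundness.
  Nat.rec (motive := fun _ => Nat → Nat → Nat → Bool) (fun _ _ _ => false)
    (fun _ ih D A used => pick D A (leaf A) (expand ih D A used)) fuel

end StarSearch

/-! ### Strip colorings, their numbering, and soundness of constraint propagation -/

namespace StarSearch

/-! ### Strips -/

/-- A coloring of the edges of the product of a 6-cycle and a two-way infinite path: `V i j` is the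
color of the edge from `(i, j)` to `(i + 1, j)`, and `H i j` that of the edge from `(i, j)` to
`(i, j + 1)`. -/
structure Strip where
  V : ZMod 6 → ℤ → ℕ
  H : ZMod 6 → ℤ → ℕ

/-- The four directions at a vertex. -/
inductive Dir
  | U | D | R | L
  deriving DecidableEq

namespace Strip

/-- The neighbor of `p` in direction `d`. -/
def nbr (p : ZMod 6 × ℤ) : Dir → ZMod 6 × ℤ
  | .U => (p.1 + 1, p.2)
  | .D => (p.1 - 1, p.2)
  | .R => (p.1, p.2 + 1)
  | .L => (p.1, p.2 - 1)

/-- The color of the edge from `p` in direction `d`. -/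
def col (s : Strip) (p : ZMod 6 × ℤ) : Dir → ℕ
  | .U => s.V p.1 p.2
  | .D => s.V (p.1 - 1) p.2
  | .R => s.H p.1 p.2
  | .L => s.H p.1 (p.2 - 1)

/-- The color `x` occurs at the vertex `p`. -/
def Occurs (s : Strip) (p : ZMod 6 × ℤ) (x : ℕ) : Prop := ∃ d, s.col p d = x

/-- Star edge colorings with the colors `0, …, 5`. -/
structure Valid (s : Strip) : Prop where
  lt : ∀ p d, s.col p d < 6
  proper : ∀ p d d', d ≠ d' → s.col p d ≠ s.col p d'
  star : ∀ p d d', d ≠ d' →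
    ¬ (s.Occurs (nbr p d) (s.col p d') ∧ s.Occurs (nbr p d') (s.col p d))

end Strip

open Strip

/-- The vertex with number `v`. -/
def vert (v : ℕ) : ZMod 6 × ℤ := (v, (v / 6 : ℕ) - 8)

/-- The color of the edge with number `e`. -/
def code (s : Strip) (e : ℕ) : ℕ :=
  if e % 2 = 0 then s.V (vert (e / 2)).1 (vert (e / 2)).2
  else s.H (vert (e / 2)).1 (vert (e / 2)).2

/-! ### Basic properties of the search functions -/

@[simp] theorem sel_true {α : Type} (x y : α) : sel true x y = x := rfl

theorem sel_eq_ite {α : Type} (b : Bool) (x y : α) : sel b x y = if b then x else y := by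
  cases b <;> rfl

@[simp] theorem force_eq {α : Type} (n : ℕ) (k : ℕ → α) : force n k = k n := by
  cases n <;> rfl

theorem tb_eq (a k : ℕ) : tb a k = a.testBit k := by
  have h : tb a k = Nat.beq ((a >>> k) % 2) 1 := rfl
  rw [h, Nat.testBit_eq_decide_div_mod_eq, Nat.shiftRight_eq_div_pow]
  rcases Nat.mod_two_eq_zero_or_one (a / 2 ^ k) with h | h <;> rw [h] <;> rfl

theorem testBit_bit (k i : ℕ) : (bit k).testBit i = decide (k = i) := by
  have : bit k = 2 ^ k := by
    show 1 <<< k = _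
    rw [Nat.one_shiftLeft]
  rw [this, Nat.testBit_two_pow]

theorem testBit_clear (a b i : ℕ) : (clear a b).testBit i = (a.testBit i && !b.testBit i) := by
  have : clear a b = a ^^^ (a &&& b) := rfl
  rw [this]
  simp only [Nat.testBit_xor, Nat.testBit_and]
  cases a.testBit i <;> cases b.testBit i <;> rfl

theorem testBit_lor (a b i : ℕ) : (Nat.lor a b).testBit i = (a.testBit i || b.testBit i) :=
  Nat.testBit_or a b i

theorem testBit_land (a b i : ℕ) : (Nat.land a b).testBit i = (a.testBit i && b.testBit i) :=
  Nat.testBit_and a b i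

theorem testBit_63 (i : ℕ) : (63 : ℕ).testBit i = decide (i < 6) :=
  Nat.testBit_two_pow_sub_one 6 i

theorem testBit_fldE (a e i : ℕ) :
    (fldE a e).testBit i = (a.testBit (8 * e + i) && decide (i < 6)) := by
  have : fldE a e = (a >>> (8 * e)) &&& 63 := rfl
  rw [this, Nat.testBit_and, Nat.testBit_shiftRight, testBit_63]

theorem fldV_eq (a v : ℕ) : fldV a v = fldE a (v + 200) := rfl

theorem posE_eq (e x : ℕ) : posE e x = 8 * e + x := rfl

theorem posV_eq (v x : ℕ) : posV v x = 8 * (v + 200) + x := rfl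

theorem testBit_shift (a k i : ℕ) :
    (Nat.shiftLeft a k).testBit i = (decide (k ≤ i) && a.testBit (i - k)) :=
  Nat.testBit_shiftLeft a

theorem testBit_idx {y : ℕ} (h0 : y ≠ 0) (h : ∀ i, y.testBit i = true → i < 6) :
    y.testBit (idx y) = true ∧ idx y < 6 := by
  unfold idx
  simp only [tb_eq, sel_eq_ite]
  split_ifs <;> simp_all
  obtain ⟨i, hi⟩ := Nat.exists_testBit_of_ne_zero h0
  have := h i hi
  interval_cases i <;> simp_all

theorem fldE_ne_zero {a e : ℕ} (h : fldE a e ≠ 0) :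
    a.testBit (8 * e + idx (fldE a e)) = true ∧ idx (fldE a e) < 6 := by
  have := testBit_idx h (fun i hi => by rw [testBit_fldE] at hi; simp at hi; exact hi.2)
  rw [testBit_fldE] at this
  simpa using this

/-! ### Numbered vertices and edges -/

/-- The number of the edge from the vertex `v` in direction `d`. -/
noncomputable def edgeNo (v : ℕ) : Dir → ℕ
  | .U => 2 * v
  | .D => 2 * dn v
  | .R => 2 * v + 1
  | .L => 2 * v - 11

/-- The number of the neighbor of the vertex `v` in direction `d`. -/
noncomputable def nbrNo (v : ℕ) : Dir → ℕ
  | .U => up v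
  | .D => dn v
  | .R => v + 6
  | .L => v - 6

theorem up_eq (v : ℕ) : up v = if v % 6 = 5 then v - 5 else v + 1 := by
  have : up v = sel (Nat.beq (v % 6) 5) (v - 5) (v + 1) := rfl
  rw [this, sel_eq_ite]; simp

theorem dn_eq (v : ℕ) : dn v = if v % 6 = 0 then v + 5 else v - 1 := by
  have : dn v = sel (Nat.beq (v % 6) 0) (v + 5) (v - 1) := rfl
  rw [this, sel_eq_ite]; simp

theorem nb_eq (v : ℕ) : nb v = .cons (edgeNo v .U) (nbrNo v .U) (.cons (edgeNo v .D) (nbrNo v .D)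
    (.cons (edgeNo v .R) (nbrNo v .R) (.cons (edgeNo v .L) (nbrNo v .L) .nil))) := by
  simp only [nb, fcons, force_eq]
  rfl

theorem cast_zmod_eq {a b : ℕ} (h : a % 6 = b % 6) : (a : ZMod 6) = b :=
  (ZMod.natCast_eq_natCast_iff a b 6).2 h

theorem vert_up (v : ℕ) : vert (up v) = nbr (vert v) .U := by
  rw [up_eq]
  refine Prod.ext ?_ ?_
  · show ((_ : ℕ) : ZMod 6) = (v : ZMod 6) + 1
    rw [← Nat.cast_succ]
    apply cast_zmod_eq
    split_ifs <;> omega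
  · show ((_ : ℕ) : ℤ) - 8 = ((v / 6 : ℕ) : ℤ) - 8
    split_ifs <;> omega

theorem vert_dn (v : ℕ) : vert (dn v) = nbr (vert v) .D := by
  rw [dn_eq]
  refine Prod.ext ?_ ?_
  · show ((_ : ℕ) : ZMod 6) = (v : ZMod 6) - 1
    rw [eq_sub_iff_add_eq, ← Nat.cast_succ]
    apply cast_zmod_eq
    split_ifs <;> omega
  · show ((_ : ℕ) : ℤ) - 8 = ((v / 6 : ℕ) : ℤ) - 8
    split_ifs <;> omega

theorem vert_add (v : ℕ) : vert (v + 6) = nbr (vert v) .R := by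
  refine Prod.ext ?_ ?_
  · exact cast_zmod_eq (by omega)
  · show (((v + 6) / 6 : ℕ) : ℤ) - 8 = ((v / 6 : ℕ) : ℤ) - 8 + 1
    omega

theorem vert_sub {v : ℕ} (hv : 6 ≤ v) : vert (v - 6) = nbr (vert v) .L := by
  refine Prod.ext ?_ ?_
  · exact cast_zmod_eq (by omega)
  · show (((v - 6) / 6 : ℕ) : ℤ) - 8 = ((v / 6 : ℕ) : ℤ) - 8 - 1
    omega

theorem vert_nbrNo {v : ℕ} (hv : 6 ≤ v) (d : Dir) : vert (nbrNo v d) = nbr (vert v) d := by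
  cases d
  · exact vert_up v
  · exact vert_dn v
  · exact vert_add v
  · exact vert_sub hv

theorem code_even (s : Strip) (v : ℕ) : code s (2 * v) = s.V (vert v).1 (vert v).2 := by
  simp [code]

theorem code_odd (s : Strip) (v : ℕ) : code s (2 * v + 1) = s.H (vert v).1 (vert v).2 := by
  have h1 : (2 * v + 1) % 2 = 1 := by omega
  have h2 : (2 * v + 1) / 2 = v := by omega
  simp [code, h1, h2]

theorem code_edgeNo (s : Strip) {v : ℕ} (hv : 6 ≤ v) (d : Dir) :
    code s (edgeNo v d) = s.col (vert v) d := by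
  cases d
  · exact code_even s v
  · rw [edgeNo, code_even, vert_dn]; rfl
  · exact code_odd s v
  · have : edgeNo v .L = 2 * (v - 6) + 1 := by simp only [edgeNo]; omega
    rw [this, code_odd, vert_sub hv]; rfl

theorem nbrNo_ge {v : ℕ} (d : Dir) : v - 6 ≤ nbrNo v d := by
  cases d <;> simp only [nbrNo, up_eq, dn_eq] <;> (try split_ifs) <;> omega

theorem nbrNo_lt {v : ℕ} (d : Dir) : nbrNo v d ≤ v + 6 := by
  cases d <;> simp only [nbrNo, up_eq, dn_eq] <;> (try split_ifs) <;> omega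

theorem edgeNo_le {v : ℕ} (d : Dir) : edgeNo v d ≤ 2 * v + 10 := by
  cases d <;> simp only [edgeNo, dn_eq] <;> (try split_ifs) <;> omega

theorem edgeNo_ge {v : ℕ} (d : Dir) : 2 * v - 11 ≤ edgeNo v d := by
  cases d <;> simp only [edgeNo, dn_eq] <;> (try split_ifs) <;> omega

theorem eu_eq (e : ℕ) : eu e = e / 2 := rfl

theorem ew_eq (e : ℕ) : ew e = if e % 2 = 0 then up (e / 2) else e / 2 + 6 := by
  have : ew e = sel (Nat.beq (e % 2) 0) (up (e / 2)) (e / 2 + 6) := rfl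
  rw [this, sel_eq_ite]; simp

/-- Reversal of directions. -/
def Dir.rev : Dir → Dir
  | .U => .D
  | .D => .U
  | .R => .L
  | .L => .R

theorem Strip.nbr_rev (p : ZMod 6 × ℤ) (d : Dir) : nbr (nbr p d) d.rev = p := by
  cases d <;> simp [nbr, Dir.rev]

theorem Strip.col_rev (s : Strip) (p : ZMod 6 × ℤ) (d : Dir) :
    s.col (nbr p d) d.rev = s.col p d := by
  cases d <;> simp [nbr, Dir.rev, col]

theorem up_dn (v : ℕ) : up (dn v) = v := by
  rw [dn_eq, up_eq]; split_ifs <;> omega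

theorem dn_up (v : ℕ) : dn (up v) = v := by
  rw [dn_eq, up_eq]; split_ifs <;> omega

theorem edgeNo_rev {v : ℕ} (hv : 6 ≤ v) (d : Dir) : edgeNo (nbrNo v d) d.rev = edgeNo v d := by
  cases d <;> simp only [edgeNo, nbrNo, Dir.rev, dn_up]
  all_goals omega

theorem nbrNo_rev {v : ℕ} (hv : 6 ≤ v) (d : Dir) : nbrNo (nbrNo v d) d.rev = v := by
  cases d <;> simp only [nbrNo, Dir.rev, dn_up, up_dn]
  all_goals omega

theorem edge_ends (e : ℕ) : ∃ d, edgeNo (eu e) d = e ∧ nbrNo (eu e) d = ew e := by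
  rw [ew_eq, eu_eq]
  rcases Nat.mod_two_eq_zero_or_one e with h | h
  · exact ⟨.U, by simp only [edgeNo]; omega, by rw [if_pos h]; rfl⟩
  · exact ⟨.R, by simp only [edgeNo]; omega, by rw [if_neg (by omega)]; rfl⟩

/-- Membership in a list of pairs. -/
def Nbs.Mem (q z : ℕ) : Nbs → Prop
  | .nil => False
  | .cons q' z' l => (q = q' ∧ z = z') ∨ Nbs.Mem q z l

theorem mem_nb {q z v : ℕ} : (nb v).Mem q z ↔ ∃ d, q = edgeNo v d ∧ z = nbrNo v d := by
  rw [nb_eq]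
  simp only [Nbs.Mem]
  constructor
  · rintro (h | h | h | h | h)
    exacts [⟨_, h⟩, ⟨_, h⟩, ⟨_, h⟩, ⟨_, h⟩, h.elim]
  · rintro ⟨d, h⟩
    cases d <;> simp [h]

theorem mem_filt {q z e : ℕ} {l acc : Nbs} (h : (filt l e acc).Mem q z) :
    (l.Mem q z ∧ q ≠ e) ∨ acc.Mem q z := by
  induction l generalizing acc with
  | nil => exact Or.inr h
  | cons q' z' l ih =>
    have h' : (sel (Nat.beq q' e) (filt l e acc) (filt l e (.cons q' z' acc))).Mem q z := h
    rw [sel_eq_ite] at h'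
    split_ifs at h' with hq
    · rcases ih h' with h | h
      · exact Or.inl ⟨Or.inr h.1, h.2⟩
      · exact Or.inr h
    · rcases ih h' with h1 | h1 | h1
      · exact Or.inl ⟨Or.inr h1.1, h1.2⟩
      · refine Or.inl ⟨Or.inl h1, ?_⟩
        rintro rfl
        simp [h1.1] at hq
      · exact Or.inr h1

theorem mem_nbq {q z v e : ℕ} (h : (nbq v e).Mem q z) :
    (∃ d, q = edgeNo v d ∧ z = nbrNo v d) ∧ q ≠ e := by
  rcases mem_filt h with h | h
  · exact ⟨mem_nb.1 h.1, h.2⟩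
  · exact h.elim

/-! ### Soundness of the propagation -/

/-- `y` could be the color `k` after a renaming of the colors `≥ used`. -/
def Adm (used k y : ℕ) : Prop := y = k ∨ (used ≤ k ∧ used ≤ y ∧ y < 6)

/-- `D` contains the possible colors. -/
def Dom (s : Strip) (used D : ℕ) : Prop :=
  ∀ f, 36 ≤ f → f < 156 → ∀ y, y < 6 → Adm used (code s f) y → D.testBit (8 * f + y) = true

/-- The colors in `M` can be removed. -/
def Bad (s : Strip) (used M : ℕ) : Prop :=
  ∀ f, 36 ≤ f → f < 156 → ∀ y, y < 6 → M.testBit (8 * f + y) = true → y < used ∧ code s f ≠ y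

/-- `A` contains correct assignments. -/
structure Asg (s : Strip) (used A : ℕ) : Prop where
  -- Bytes below 8 hold the salt, and bytes from 200 on belong to vertices.
  edge : ∀ f x, 8 ≤ f → f < 200 → x < 6 → A.testBit (8 * f + x) = true → code s f = x ∧ x < used
  vertex : ∀ v x, x < 6 → A.testBit (8 * (v + 200) + x) = true → s.Occurs (vert v) x ∧ x < used

/-- A color below `used` is admissible at an edge only if it is the actual color there. This is why
`Bad` restricts removals to colors already in use: the unused ones stay interchangeable. -/
theorem Dom.clear {s : Strip} {used D M : ℕ} (hD : Dom s used D) (hM : Bad s used M) :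
    Dom s used (clear D M) := by
  intro f hf hf' y hy ha
  rw [testBit_clear, hD f hf hf' y hy ha]
  by_contra hM'
  have := hM f hf hf' y hy (by simpa using hM')
  rcases ha with rfl | ha
  · exact this.2 rfl
  · omega

theorem Bad.lor {s : Strip} {used M N : ℕ} (hM : Bad s used M) (hN : Bad s used N) :
    Bad s used (Nat.lor M N) := by
  intro f hf hf' y hy h
  rw [testBit_lor, Bool.or_eq_true] at h
  rcases h with h | h
  · exact hM f hf hf' y hy h
  · exact hN f hf hf' y hy h

theorem Bad.zero (s : Strip) (used : ℕ) : Bad s used 0 := by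
  intro f _ _ y _ h
  simp at h

theorem testBit_edgeMask {l : Nbs} {i : ℕ} (h : (edgeMask l).testBit i = true) :
    ∃ q z, l.Mem q z ∧ i = 8 * q := by
  induction l with
  | nil =>
    have : (0 : ℕ).testBit i = true := h
    simp at this
  | cons q z l ih =>
    have h' : (Nat.lor (bit (8 * q)) (edgeMask l)).testBit i = true := h
    rw [testBit_lor, testBit_bit, Bool.or_eq_true] at h'
    rcases h' with h | h
    · exact ⟨q, z, Or.inl ⟨rfl, rfl⟩, by simpa using (of_decide_eq_true h).symm⟩
    · obtain ⟨q', z', hm, hi⟩ := ih h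
      exact ⟨q', z', Or.inr hm, hi⟩

theorem testBit_veS {v x f y : ℕ} (hx : x < 6) (hy : y < 6)
    (h : (veS v x).testBit (8 * f + y) = true) : y = x ∧ ∃ d, f = edgeNo v d := by
  have h' : (Nat.shiftLeft (edgeMask (nb v)) x).testBit (8 * f + y) = true := h
  rw [testBit_shift, Bool.and_eq_true] at h'
  obtain ⟨q, z, hm, hi⟩ := testBit_edgeMask h'.2
  have := of_decide_eq_true h'.1
  obtain ⟨d, hd, -⟩ := mem_nb.1 hm
  exact ⟨by omega, d, by omega⟩

theorem Bad.veS {s : Strip} {used v x : ℕ} (hv : 6 ≤ v) (hx : x < 6) (hu : x < used)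
    (h : ¬ s.Occurs (vert v) x) : Bad s used (veS v x) := by
  intro f hf hf' y hy hb
  obtain ⟨rfl, d, rfl⟩ := testBit_veS hx hy hb
  rw [code_edgeNo s hv]
  exact ⟨hu, fun h' => h ⟨d, h'⟩⟩

theorem Asg.fldV {s : Strip} {used A : ℕ} (hA : Asg s used A) {v x : ℕ}
    (h : (fldV A v).testBit x = true) : x < 6 ∧ s.Occurs (vert v) x ∧ x < used := by
  rw [fldV_eq, testBit_fldE] at h
  simp only [Bool.and_eq_true, decide_eq_true_eq] at h
  exact ⟨h.2, hA.vertex v x h.2 h.1⟩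

theorem Asg.fldE {s : Strip} {used A : ℕ} (hA : Asg s used A) {f : ℕ} (h8 : 8 ≤ f) (h : f < 200)
    (h0 : fldE A f ≠ 0) : code s f = idx (fldE A f) ∧ idx (fldE A f) < used := by
  have := fldE_ne_zero h0
  exact hA.edge f _ h8 h this.2 this.1

/-- The edge of color `x` from `u` to `w`. -/
structure Link (s : Strip) (e x u w : ℕ) : Prop where
  -- The bounds come from the window `36 ≤ e < 156`. They keep the edges and vertices reached in two
  -- further steps inside the ranges of `Asg` and of `code_edgeNo`.
  hu : 18 ≤ u
  hu' : u ≤ 83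
  edge : ∃ d, edgeNo u d = e ∧ nbrNo u d = w
  color : code s e = x

theorem Link.symm {s : Strip} {e x u w : ℕ} (h : Link s e x u w) (hw : 18 ≤ w) (hw' : w ≤ 83) :
    Link s e x w u := by
  obtain ⟨d, rfl, rfl⟩ := h.edge
  exact ⟨hw, hw', ⟨d.rev, edgeNo_rev (by have := h.hu; omega) d,
    nbrNo_rev (by have := h.hu; omega) d⟩, h.color⟩

theorem Link.occurs {s : Strip} {e x u w : ℕ} (h : Link s e x u w) : s.Occurs (vert u) x := by
  obtain ⟨d, rfl, rfl⟩ := h.edge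
  exact ⟨d, by rw [← code_edgeNo s (by have := h.hu; omega), h.color]⟩

/-- If `x` occurs at the neighbor `z` of `u`, then the color of `uz` does not occur at `w`. -/
theorem Link.not_occurs {s : Strip} (hs : s.Valid) {e x u w q z : ℕ} (h : Link s e x u w)
    (hq : (nbq u e).Mem q z) : ¬ (s.Occurs (vert z) x ∧ s.Occurs (vert w) (code s q)) := by
  obtain ⟨d, rfl, rfl⟩ := h.edge
  obtain ⟨⟨d', rfl, rfl⟩, hne⟩ := mem_nbq hq
  have hu : 6 ≤ u := by have := h.hu; omega
  have hd : d ≠ d' := by rintro rfl; exact hne rfl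
  have := hs.star (vert u) d d' hd
  rw [vert_nbrNo hu, vert_nbrNo hu, code_edgeNo s hu, ← h.color, code_edgeNo s hu]
  tauto

/-- The star condition at the middle vertex `z` rather than at `u`: `x` occurs at `u` through the
edge `uw`, so the color of `q` cannot occur at the far end of the edge of color `x` at `z`. -/
theorem Link.not_occurs_far {s : Strip} (hs : s.Valid) {e x u w q z p t : ℕ}
    (h : Link s e x u w) (hq : (nbq u e).Mem q z) (hp : (nbq z q).Mem p t) (hc : code s p = x) :
    ¬ s.Occurs (vert t) (code s q) := by
  have hx := h.occurs
  obtain ⟨⟨d', rfl, rfl⟩, hne⟩ := mem_nbq hq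
  obtain ⟨⟨a, rfl, rfl⟩, hne'⟩ := mem_nbq hp
  have hu : 6 ≤ u := by have := h.hu; omega
  have hz : 6 ≤ nbrNo u d' := by have := h.hu; have := nbrNo_ge (v := u) d'; omega
  have hd : a ≠ d'.rev := by rintro rfl; exact hne' (edgeNo_rev hu d')
  have := hs.star (vert (nbrNo u d')) a d'.rev hd
  rw [← vert_nbrNo hz, ← vert_nbrNo hz, nbrNo_rev hu, ← code_edgeNo s hz, ← code_edgeNo s hz,
    edgeNo_rev hu, hc] at this
  tauto

theorem Link.bounds {s : Strip} {e x u w q z : ℕ} (h : Link s e x u w) (hq : (nbq u e).Mem q z) :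
    8 ≤ q ∧ q < 200 ∧ 12 ≤ z ∧ z ≤ 89 := by
  obtain ⟨⟨d', rfl, rfl⟩, hne⟩ := mem_nbq hq
  have := h.hu
  have := h.hu'
  have := nbrNo_ge (v := u) d'
  have := nbrNo_lt (v := u) d'
  have := edgeNo_ge (v := u) d'
  have := edgeNo_le (v := u) d'
  omega

theorem mem_nbq_bounds {v e q z : ℕ} (hv : 12 ≤ v) (hv' : v ≤ 89) (hq : (nbq v e).Mem q z) :
    8 ≤ q ∧ q < 200 ∧ 6 ≤ z := by
  obtain ⟨⟨d', rfl, rfl⟩, hne⟩ := mem_nbq hq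
  have := nbrNo_ge (v := v) d'
  have := edgeNo_ge (v := v) d'
  have := edgeNo_le (v := v) d'
  omega

theorem testBit_farSet {A x i : ℕ} {l : Nbs} (h : (farSet A x l).testBit i = true) :
    ∃ p t, l.Mem p t ∧ A.testBit (8 * p + x) = true ∧ (fldV A t).testBit i = true := by
  induction l with
  | nil =>
    have : (0 : ℕ).testBit i = true := h
    simp at this
  | cons p t l ih =>
    have h' : (sel (tb A (8 * p + x)) (fldV A t) (farSet A x l)).testBit i = true := h
    rw [tb_eq, sel_eq_ite] at h'
    split_ifs at h' with hb
    · exact ⟨p, t, Or.inl ⟨rfl, rfl⟩, hb, h'⟩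
    · obtain ⟨p', t', hm, h''⟩ := ih h'
      exact ⟨p', t', Or.inr hm, h''⟩

theorem Bad.farMask {s : Strip} {used A x k : ℕ} {l : Nbs}
    (h : ∀ p t, l.Mem p t → A.testBit (8 * p + x) = true → Bad s used (StarSearch.veS t k)) :
    Bad s used (farMask A x k l) := by
  induction l with
  | nil => exact Bad.zero s used
  | cons p t l ih =>
    have h' : StarSearch.farMask A x k (.cons p t l) =
      sel (tb A (8 * p + x)) (StarSearch.veS t k) (StarSearch.farMask A x k l) := rfl
    rw [h', tb_eq, sel_eq_ite]
    split_ifs with hb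
    · exact h p t (Or.inl ⟨rfl, rfl⟩) hb
    · exact ih fun p t hm => h p t (Or.inr hm)

/-- A set of colors at the edge `q`, as a mask. -/
theorem Bad.shift {s : Strip} {used M q : ℕ}
    (h : ∀ y, M.testBit y = true → y < 6 ∧ y < used ∧ code s q ≠ y) :
    Bad s used (Nat.shiftLeft M (8 * q)) := by
  intro f _ _ y hy hb
  rw [testBit_shift, Bool.and_eq_true] at hb
  have h1 := of_decide_eq_true hb.1
  have := h _ hb.2
  have hf : f = q := by omega
  subst hf
  have hy' : 8 * f + y - 8 * f = y := by omega
  rw [hy'] at this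
  exact this.2

/-- The hypotheses under which the color `x` of the edge `e` is propagated. -/
structure Step (s : Strip) (used used' A e x u w : ℕ) : Prop where
  valid : s.Valid
  asg : Asg s used A
  -- `A` still describes the state before the assignment, whereas the possible colors are already
  -- measured against the new count `used'`.
  le : used ≤ used'
  lt : x < used'
  link : Link s e x u w
  link' : Link s e x w u

theorem Step.symm {s : Strip} {used used' A e x u w : ℕ} (h : Step s used used' A e x u w) :
    Step s used used' A e x w u :=
  ⟨h.valid, h.asg, h.le, h.lt, h.link', h.link⟩

theorem Valid.code_lt {s : Strip} (hs : s.Valid) (e : ℕ) : code s e < 6 := by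
  unfold code
  split_ifs
  · exact hs.lt (vert (e / 2)) .U
  · exact hs.lt (vert (e / 2)) .R

theorem Step.x_lt {s : Strip} {used used' A e x u w : ℕ} (h : Step s used used' A e x u w) :
    x < 6 := h.link.color ▸ Valid.code_lt h.valid e

theorem Step.hit {s : Strip} {used used' A e x u w q z : ℕ} (h : Step s used used' A e x u w)
    (hq : (nbq u e).Mem q z) (hz : s.Occurs (vert z) x) {ih : ℕ → ℕ}
    (hih : ∀ D, Dom s used' D → Dom s used' (ih D)) {D : ℕ} (hD : Dom s used' D) :
    Dom s used' (hit A x w q z ih D (fldE A q)) := by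
  have hb := h.link.bounds hq
  have h1 : ¬ s.Occurs (vert w) (code s q) := fun h' =>
    h.link.not_occurs h.valid hq ⟨hz, h'⟩
  have h2 : ∀ p t, (nbq z q).Mem p t → A.testBit (8 * p + x) = true →
      6 ≤ t ∧ ¬ s.Occurs (vert t) (code s q) := by
    intro p t hm hA
    have hb' := mem_nbq_bounds (by omega) (by omega) hm
    exact ⟨by omega, h.link.not_occurs_far h.valid hq hm
      (h.asg.edge p x hb'.1 hb'.2.1 h.x_lt hA).1⟩
  have hle := h.le
  unfold StarSearch.hit
  rw [sel_eq_ite]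
  split_ifs with h0
  · refine hih _ (hD.clear (Bad.shift fun y hy => ?_))
    rw [testBit_lor, Bool.or_eq_true] at hy
    rcases hy with hy | hy
    · obtain ⟨h6, ho, hu⟩ := h.asg.fldV hy
      exact ⟨h6, by omega, fun h' => h1 (h' ▸ ho)⟩
    · obtain ⟨p, t, hm, hA, hy⟩ := testBit_farSet hy
      obtain ⟨h6, ho, hu⟩ := h.asg.fldV hy
      exact ⟨h6, by omega, fun h' => (h2 p t hm hA).2 (h' ▸ ho)⟩
  -- Here `q` is already colored, so instead of shrinking its own set, its color is deleted from all
  -- edges at `w` and at the far ends.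
  · have h0' : fldE A q ≠ 0 := by
      intro h'
      rw [h'] at h0
      exact h0 rfl
    obtain ⟨hc, hu⟩ := h.asg.fldE hb.1 hb.2.1 h0'
    have h6 := Valid.code_lt h.valid q
    rw [← hc] at hu ⊢
    refine hih _ (hD.clear (Bad.lor (Bad.veS ?_ h6 (by omega) h1) (Bad.farMask ?_)))
    · have := h.link'.hu
      omega
    · intro p t hm hA
      exact Bad.veS (h2 p t hm hA).1 h6 (by omega) (h2 p t hm hA).2

theorem Step.hits {s : Strip} {used used' A e x u w h' : ℕ} (h : Step s used used' A e x u w)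
    (hh : ∀ i, h'.testBit i = true → A.testBit i = true) {l : Nbs}
    (hl : ∀ q z, l.Mem q z → (nbq u e).Mem q z) {D : ℕ} (hD : Dom s used' D) :
    Dom s used' (hits A h' x w l D) := by
  induction l generalizing D with
  | nil => exact hD
  | cons q z l ih =>
    have hi : ∀ D, Dom s used' D → Dom s used' (StarSearch.hits A h' x w l D) := fun D hD =>
      ih (fun q z hm => hl q z (Or.inr hm)) hD
    show Dom s used' (sel (tb h' (posV z x)) (StarSearch.hit A x w q z
      (StarSearch.hits A h' x w l) D (StarSearch.fldE A q)) (StarSearch.hits A h' x w l D))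
    rw [sel_eq_ite, tb_eq]
    split_ifs with hb
    · exact h.hit (hl q z (Or.inl ⟨rfl, rfl⟩)) (h.asg.vertex z x h.x_lt (hh _ hb)).1 hi hD
    · exact hi D hD

theorem Step.meets {s : Strip} {used used' A e x u w m : ℕ} (h : Step s used used' A e x u w)
    (hm : ∀ i, m.testBit i = true → s.Occurs (vert w) i) {l : Nbs}
    (hl : ∀ q z, l.Mem q z → (nbq u e).Mem q z) {D : ℕ} (hD : Dom s used' D) :
    Dom s used' (meets A m x l D) := by
  induction l generalizing D with
  | nil => exact hD
  | cons q z l ih =>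
    have hi : ∀ D, Dom s used' D → Dom s used' (StarSearch.meets A m x l D) := fun D hD =>
      ih (fun q z hm => hl q z (Or.inr hm)) hD
    show Dom s used' (sel (Nat.beq (Nat.land (StarSearch.fldE A q) m) 0)
      (StarSearch.meets A m x l D) (StarSearch.meets A m x l (clear D (StarSearch.veS z x))))
    rw [sel_eq_ite]
    have hq := hl q z (Or.inl ⟨rfl, rfl⟩)
    split_ifs with hb
    · exact hi D hD
    · refine hi _ (hD.clear (Bad.veS (by have := h.link.bounds hq; omega) h.x_lt h.lt ?_))
      have h0 : Nat.land (StarSearch.fldE A q) m ≠ 0 := by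
        intro h'
        rw [h'] at hb
        exact hb rfl
      obtain ⟨i, hi⟩ := Nat.exists_testBit_of_ne_zero h0
      rw [testBit_land, Bool.and_eq_true, testBit_fldE, Bool.and_eq_true] at hi
      have hbd := h.link.bounds hq
      have hc := (h.asg.edge q i hbd.1 hbd.2.1 (of_decide_eq_true hi.1.2) hi.1.1).1
      intro ho
      exact h.link.not_occurs h.valid hq ⟨ho, hc ▸ hm i hi.2⟩

theorem Step.propagate {s : Strip} {used used' A e x D : ℕ}
    (h : Step s used used' A e x (eu e) (ew e)) (hD : Dom s used' D) :
    Dom s used' (propagate A e x D (eu e) (ew e)) := by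
  have h1 : Dom s used' (propagateMeets A e x (Nat.land (StarSearch.fldV A (eu e))
      (StarSearch.fldV A (ew e))) D) := by
    unfold propagateMeets
    rw [sel_eq_ite]
    split_ifs
    · exact hD
    · refine h.meets (fun i hi => ?_) (fun _ _ hm => hm)
        (h.symm.meets (fun i hi => ?_) (fun _ _ hm => hm) hD)
      · rw [testBit_land, Bool.and_eq_true] at hi
        exact (h.asg.fldV hi.2).2.1
      · rw [testBit_land, Bool.and_eq_true] at hi
        exact (h.asg.fldV hi.1).2.1
  unfold StarSearch.propagate propagateHits
  rw [sel_eq_ite]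
  split_ifs
  · exact h1
  · have hh : ∀ i, (Nat.land A (endsMask e x)).testBit i = true → A.testBit i = true := by
      intro i hi
      rw [testBit_land, Bool.and_eq_true] at hi
      exact hi.1
    exact h.hits hh (fun _ _ hm => hm) (h.symm.hits hh (fun _ _ hm => hm) h1)

theorem testBit_low {n i : ℕ} (hn : n < 2 ^ 64) (hi : 64 ≤ i) : n.testBit i = false :=
  Nat.testBit_lt_two_pow (hn.trans_le (Nat.pow_le_pow_right (by norm_num) hi))

theorem salt_lt (e x : ℕ) : salt e x < 2 ^ 64 :=
  (Nat.mod_lt _ (by norm_num)).trans (by norm_num)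

theorem salt'_lt (e x : ℕ) : salt' e x < 2 ^ 64 :=
  (Nat.mod_lt _ (by norm_num)).trans (by norm_num)

theorem Dom.mono {s : Strip} {used used' D : ℕ} (hD : Dom s used D) (h : used ≤ used') :
    Dom s used' D := by
  intro f hf hf' y hy ha
  refine hD f hf hf' y hy ?_
  rcases ha with ha | ha
  · exact Or.inl ha
  · exact Or.inr ⟨by omega, by omega, ha.2.2⟩

/-- Properness: `x` disappears from the edges sharing an endpoint with `e`, and `e` keeps only `x`.
Renamings of unused colors are not lost, because `x < used'`. -/
theorem Step.dom_adj {s : Strip} {used used' A e x D : ℕ}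
    (h : Step s used used' A e x (eu e) (ew e)) (hD : Dom s used' D) :
    Dom s used' (Nat.lor (clear D (adjx e x)) (bit (posE e x))) := by
  intro f hf hf' y hy ha
  have hx := h.x_lt
  rw [testBit_lor, testBit_bit, testBit_clear, hD f hf hf' y hy ha, posE_eq]
  by_cases hc : 8 * e + x = 8 * f + y
  · simp [hc]
  have hnot : (adjx e x).testBit (8 * f + y) = false := by
    by_contra hb
    have hb : (Nat.lor (Nat.lor (veS (eu e) x) (veS (ew e) x))
      (Nat.shiftLeft 63 (8 * e))).testBit (8 * f + y) = true := Bool.eq_true_of_not_eq_false hb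
    rw [testBit_lor, testBit_lor, Bool.or_eq_true, Bool.or_eq_true, testBit_shift] at hb
    have key : ∀ u w, Link s e x u w → (veS u x).testBit (8 * f + y) = true → False := by
      intro u w hl hb
      obtain ⟨rfl, d, rfl⟩ := testBit_veS hx hy hb
      obtain ⟨d', hd', -⟩ := hl.edge
      have hu : 6 ≤ u := by have := hl.hu; omega
      have hcol := hl.color
      rw [← hd', code_edgeNo s hu] at hcol
      rw [code_edgeNo s hu] at ha
      have hlt := h.lt
      rcases ha with ha | ha
      · have : d = d' := by
          by_contra hne
          exact h.valid.proper (vert u) d d' hne (by omega)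
        subst this
        exact hc (by rw [hd'])
      · omega
    rcases hb with (hb | hb) | hb
    · exact key _ _ h.link hb
    · exact key _ _ h.link' hb
    · rw [Bool.and_eq_true, testBit_63] at hb
      have h1 := of_decide_eq_true hb.1
      have h2 := of_decide_eq_true hb.2
      have hfe : f = e := by omega
      subst hfe
      have := h.lt
      rcases ha with ha | ha
      · exact hc (by rw [ha, h.link.color])
      · rw [h.link.color] at ha
        omega
  simp [hnot]

theorem Step.dom {s : Strip} {used used' A e x D : ℕ}
    (h : Step s used used' A e x (eu e) (ew e)) (hD : Dom s used D) :
    Dom s used' (assignD D A e x) := by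
  have h1 := h.propagate (h.dom_adj (hD.mono h.le))
  intro f hf hf' y hy ha
  have : assignD D A e x = StarSearch.propagate A e x (Nat.lor (StarSearch.clear D (adjx e x))
    (bit (posE e x))) (eu e) (ew e) ^^^ salt e x := rfl
  rw [this, Nat.testBit_xor, testBit_low (salt_lt e x) (by omega), h1 f hf hf' y hy ha]
  rfl

theorem testBit_assignMask {e x i : ℕ} (h : (assignMask e x).testBit i = true) :
    i = 8 * e + x ∨ i = 8 * e + 6 ∨ i = 8 * (eu e + 200) + x ∨ i = 8 * (ew e + 200) + x := by
  have h' : (Nat.lor (Nat.lor (bit (posE e x)) (bit (posE e 6)))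
    (Nat.lor (bit (posV (eu e) x)) (bit (posV (ew e) x)))).testBit i = true := h
  simp only [testBit_lor, testBit_bit, posE_eq, posV_eq, Bool.or_eq_true, decide_eq_true_eq] at h'
  omega

theorem Step.asg_assign {s : Strip} {used used' A e x : ℕ}
    (h : Step s used used' A e x (eu e) (ew e)) (he : e < 200) :
    Asg s used' (assignA A e x) := by
  have h0 : assignA A e x = (A ||| assignMask e x) ^^^ salt' e x := rfl
  have hx := h.x_lt
  have hle := h.le
  have hlt := h.lt
  constructor
  · intro f y hf hf' hy hb
    rw [h0, Nat.testBit_xor, testBit_low (salt'_lt e x) (by omega), Nat.testBit_or,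
      Bool.xor_false, Bool.or_eq_true] at hb
    rcases hb with hb | hb
    · have := h.asg.edge f y hf hf' hy hb
      exact ⟨this.1, by omega⟩
    · rcases testBit_assignMask hb with hb | hb | hb | hb
      · have : f = e := by omega
        subst this
        have : y = x := by omega
        subst this
        exact ⟨h.link.color, hlt⟩
      all_goals omega
  · intro v y hy hb
    rw [h0, Nat.testBit_xor, testBit_low (salt'_lt e x) (by omega), Nat.testBit_or,
      Bool.xor_false, Bool.or_eq_true] at hb
    rcases hb with hb | hb
    · have := h.asg.vertex v y hy hb
      exact ⟨this.1, by omega⟩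
    · rcases testBit_assignMask hb with hb | hb | hb | hb
      · omega
      · omega
      · have : v = eu e := by omega
        subst this
        have : y = x := by omega
        subst this
        exact ⟨h.link.occurs, hlt⟩
      · have : v = ew e := by omega
        subst this
        have : y = x := by omega
        subst this
        exact ⟨h.link'.occurs, hlt⟩

/-- The invariant of the search. -/
structure Inv (s : Strip) (used D A : ℕ) : Prop where
  dom : Dom s used D
  asg : Asg s used A

theorem nextUsed_eq (x used : ℕ) : nextUsed x used = if x = used then used + 1 else used := by
  have : nextUsed x used = sel (Nat.beq x used) (used + 1) used := rfl
  rw [this, sel_eq_ite]; simp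

theorem Inv.assign {s : Strip} {used D A e x : ℕ} (hs : s.Valid) (h : Inv s used D A)
    (he : 36 ≤ e) (he' : e < 156) (hc : code s e = x) (hx : x ≤ used) :
    Inv s (nextUsed x used) (assignD D A e x) (assignA A e x) := by
  have hl : Link s e x (eu e) (ew e) := ⟨by rw [eu_eq]; omega, by rw [eu_eq]; omega,
    edge_ends e, hc⟩
  have hl' := hl.symm (by rw [ew_eq, up_eq]; split_ifs <;> omega)
    (by rw [ew_eq, up_eq]; split_ifs <;> omega)
  have hst : Step s used (nextUsed x used) A e x (eu e) (ew e) :=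
    ⟨hs, h.asg, by rw [nextUsed_eq]; split_ifs <;> omega,
      by rw [nextUsed_eq]; split_ifs <;> omega, hl, hl'⟩
  exact ⟨hst.dom h.dom, hst.asg_assign (by omega)⟩

end StarSearch

/-! ### Symmetries of the strip and the invariant kind of a column -/

namespace StarSearch

open Strip

namespace Strip

/-! ### Symmetries -/

/-- All symmetries at once: `σ` is a map of vertices acting on directions through `δ`, and `f`
renames the colors. -/
theorem Valid.map {s s' : Strip} (hs : s.Valid) (f : ℕ → ℕ) (hf : f.Injective)
    (h6 : ∀ x, x < 6 → f x < 6) (σ : ZMod 6 × ℤ → ZMod 6 × ℤ) (δ : Dir → Dir)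
    (hδ : δ.Injective) (hσ : ∀ p d, σ (nbr p d) = nbr (σ p) (δ d))
    (hc : ∀ p d, s'.col p d = f (s.col (σ p) (δ d))) : s'.Valid := by
  refine ⟨fun p d => ?_, fun p d d' hd => ?_, fun p d d' hd => ?_⟩
  · rw [hc]
    exact h6 _ (hs.lt _ _)
  · rw [hc, hc]
    exact fun h => hs.proper _ _ _ (fun h => hd (hδ h)) (hf h)
  · rintro ⟨⟨a, ha⟩, ⟨b, hb⟩⟩
    rw [hc, hc, hσ] at ha hb
    exact hs.star (σ p) (δ d) (δ d') (fun h => hd (hδ h)) ⟨⟨δ a, hf ha⟩, ⟨δ b, hf hb⟩⟩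

/-- Rotation. -/
def rot (k : ZMod 6) (s : Strip) : Strip := ⟨fun i j => s.V (i + k) j, fun i j => s.H (i + k) j⟩

/-- Reflection of the 6-cycle. -/
def refl (s : Strip) : Strip := ⟨fun i j => s.V (-i - 1) j, fun i j => s.H (-i) j⟩

/-- Reflection of the path. -/
def lr (s : Strip) : Strip := ⟨fun i j => s.V i (-j), fun i j => s.H i (-1 - j)⟩

/-- Translation. -/
def shift (k : ℤ) (s : Strip) : Strip := ⟨fun i j => s.V i (j + k), fun i j => s.H i (j + k)⟩

/-- Renaming of colors. -/
def recolor (f : ℕ → ℕ) (s : Strip) : Strip := ⟨fun i j => f (s.V i j), fun i j => f (s.H i j)⟩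

theorem Valid.rot {s : Strip} (hs : s.Valid) (k : ZMod 6) : (s.rot k).Valid := by
  refine hs.map id Function.injective_id (fun _ h => h) (fun p => (p.1 + k, p.2)) id
    Function.injective_id ?_ ?_
  · rintro ⟨i, j⟩ d
    cases d <;> simp only [nbr, id, Prod.mk.injEq] <;> constructor <;> first | trivial | ring
  · rintro ⟨i, j⟩ d
    cases d <;> simp only [col, id, Strip.rot]; first | rfl | (congr 1; ring)

theorem Valid.shift {s : Strip} (hs : s.Valid) (k : ℤ) : (s.shift k).Valid := by
  refine hs.map id Function.injective_id (fun _ h => h) (fun p => (p.1, p.2 + k)) id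
    Function.injective_id ?_ ?_
  · rintro ⟨i, j⟩ d
    cases d <;> simp only [nbr, id, Prod.mk.injEq] <;> constructor <;> first | trivial | ring
  · rintro ⟨i, j⟩ d
    cases d <;> simp only [col, id, Strip.shift]; first | rfl | (congr 1; ring)

theorem Valid.recolor {s : Strip} (hs : s.Valid) {f : ℕ → ℕ} (hf : f.Injective)
    (h6 : ∀ x, x < 6 → f x < 6) : (s.recolor f).Valid := by
  refine hs.map f hf h6 id id Function.injective_id (fun _ _ => rfl) ?_
  rintro ⟨i, j⟩ d
  cases d <;> rfl

theorem Valid.refl {s : Strip} (hs : s.Valid) : s.refl.Valid := by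
  refine hs.map id Function.injective_id (fun _ h => h) (fun p => (-p.1, p.2))
    (fun | .U => .D | .D => .U | .R => .R | .L => .L) ?_ ?_ ?_
  · intro a b
    cases a <;> cases b <;> simp
  · rintro ⟨i, j⟩ d
    cases d <;> simp only [nbr, Prod.mk.injEq] <;> constructor <;> first | trivial | ring
  · rintro ⟨i, j⟩ d
    cases d <;> simp only [col, id, Strip.refl]; first | rfl | (congr 1; ring)

theorem Valid.lr {s : Strip} (hs : s.Valid) : s.lr.Valid := by
  refine hs.map id Function.injective_id (fun _ h => h) (fun p => (p.1, -p.2))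
    (fun | .U => .U | .D => .D | .R => .L | .L => .R) ?_ ?_ ?_
  · intro a b
    cases a <;> cases b <;> simp
  · rintro ⟨i, j⟩ d
    cases d <;> simp only [nbr, Prod.mk.injEq] <;> constructor <;> first | trivial | ring
  · rintro ⟨i, j⟩ d
    cases d <;> simp only [col, id, Strip.lr] <;> first | rfl | (congr 1; ring)

/-! ### The local type of a strip -/

/-- The edges to the right of column `j` have the colors of edges in column `j`. -/
def RightPhase (s : Strip) (j : ℤ) : Prop :=
  ∀ i, s.H i j = s.V (i + 1) j ∨ s.H i j = s.V (i - 2) j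

/-- The edges to the left of column `j` have the colors of edges in column `j`. -/
def LeftPhase (s : Strip) (j : ℤ) : Prop :=
  ∀ i, s.H i (j - 1) = s.V (i + 1) j ∨ s.H i (j - 1) = s.V (i - 2) j

/-- The columns `j` and `k` have the same colors. -/
def SameCol (s : Strip) (j k : ℤ) : Prop := ∀ i, s.V i j = s.V i k

end Strip

/-- Exactly one of three propositions. -/
def ExactlyOne (a b c : Prop) : Prop := (a ∧ ¬ b ∧ ¬ c) ∨ (¬ a ∧ b ∧ ¬ c) ∨ (¬ a ∧ ¬ b ∧ c)

theorem exactlyOne_rev {a b c : Prop} : ExactlyOne a b c ↔ ExactlyOne c b a := by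
  unfold ExactlyOne; tauto

namespace Strip

/-- Around column `j`, exactly every third column has a phase. -/
def Phased (s : Strip) (j : ℤ) : Prop :=
  ExactlyOne (s.RightPhase (j - 1)) (s.RightPhase j) (s.RightPhase (j + 1)) ∧
    ExactlyOne (s.LeftPhase (j - 1)) (s.LeftPhase j) (s.LeftPhase (j + 1))

open Classical in
/-- The type of a strip at column `j`: `1` for phased, `2` for period 4, `3` for period 6, and `0`
for none of these. -/
noncomputable def kind (s : Strip) (j : ℤ) : ℕ :=
  if s.Phased j then 1
  else if s.SameCol (j - 2) (j + 2) ∧ ¬ s.SameCol (j - 1) (j + 1) then 2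
  else if s.SameCol (j - 3) (j + 3) ∧ ¬ s.SameCol (j - 1) (j + 1) then 3
  else 0

/-- The type is defined and locally constant. -/
def Uniform (s : Strip) : Prop :=
  s.kind (-1) = s.kind 0 ∧ s.kind 1 = s.kind 0 ∧ s.kind 0 ≠ 0

theorem kind_congr {s s' : Strip} {j k : ℤ} (h1 : s.Phased j ↔ s'.Phased k)
    (h2 : s.SameCol (j - 2) (j + 2) ↔ s'.SameCol (k - 2) (k + 2))
    (h3 : s.SameCol (j - 3) (j + 3) ↔ s'.SameCol (k - 3) (k + 3))
    (h4 : s.SameCol (j - 1) (j + 1) ↔ s'.SameCol (k - 1) (k + 1)) : s.kind j = s'.kind k := by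
  classical exact if_congr h1 rfl (if_congr (and_congr h2 (not_congr h4)) rfl
    (if_congr (and_congr h3 (not_congr h4)) rfl rfl))

theorem kind_rot (s : Strip) (k : ZMod 6) (j : ℤ) : (s.rot k).kind j = s.kind j := by
  have h1 : ∀ j, (s.rot k).RightPhase j ↔ s.RightPhase j := fun j => by
    unfold RightPhase
    rw [← (Equiv.addRight k).forall_congr_right (q := fun i => s.H i j = _ ∨ s.H i j = _)]
    refine forall_congr' fun i => ?_
    simp only [rot, Equiv.coe_addRight, add_right_comm, add_sub_right_comm]
  have h2 : ∀ j, (s.rot k).LeftPhase j ↔ s.LeftPhase j := fun j => by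
    unfold LeftPhase
    rw [← (Equiv.addRight k).forall_congr_right (q := fun i => s.H i (j - 1) = _ ∨ _)]
    refine forall_congr' fun i => ?_
    simp only [rot, Equiv.coe_addRight, add_right_comm, add_sub_right_comm]
  have h3 : ∀ a b, (s.rot k).SameCol a b ↔ s.SameCol a b := fun a b =>
    (Equiv.addRight k).forall_congr_right (q := fun i => s.V i a = s.V i b)
  exact kind_congr (by simp only [Phased, h1, h2]) (h3 _ _) (h3 _ _) (h3 _ _)

/-- Reflection carries edge `i + 1` of a column to edge `i - 2` seen from the reflected row, so it
merely swaps the two alternatives in each phase condition. -/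
theorem kind_refl (s : Strip) (j : ℤ) : s.refl.kind j = s.kind j := by
  have key : ∀ (i : ZMod 6) , -(i + 1) - 1 = -i - 2 ∧ -(i - 2) - 1 = -i + 1 :=
    fun i => ⟨by ring, by ring⟩
  have h1 : ∀ j, s.refl.RightPhase j ↔ s.RightPhase j := fun j => by
    unfold RightPhase
    rw [← (Equiv.neg (ZMod 6)).forall_congr_right (q := fun i => s.H i j = _ ∨ s.H i j = _)]
    refine forall_congr' fun i => ?_
    simp only [refl, Equiv.neg_apply, (key i).1, (key i).2]
    exact or_comm
  have h2 : ∀ j, s.refl.LeftPhase j ↔ s.LeftPhase j := fun j => by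
    unfold LeftPhase
    rw [← (Equiv.neg (ZMod 6)).forall_congr_right (q := fun i => s.H i (j - 1) = _ ∨ _)]
    refine forall_congr' fun i => ?_
    simp only [refl, Equiv.neg_apply, (key i).1, (key i).2]
    exact or_comm
  have h3 : ∀ a b, s.refl.SameCol a b ↔ s.SameCol a b := fun a b =>
    ((Equiv.neg (ZMod 6)).trans (Equiv.subRight 1)).forall_congr_right
      (q := fun i => s.V i a = s.V i b)
  exact kind_congr (by simp only [Phased, h1, h2]) (h3 _ _) (h3 _ _) (h3 _ _)

theorem SameCol.symm {s : Strip} {a b : ℤ} (h : s.SameCol a b) : s.SameCol b a :=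
  fun i => (h i).symm

theorem sameCol_comm {s : Strip} {a b : ℤ} : s.SameCol a b ↔ s.SameCol b a :=
  ⟨SameCol.symm, SameCol.symm⟩

/-- Right and left phases are exchanged, and the three columns in each `ExactlyOne` are reversed. -/
theorem kind_lr (s : Strip) (j : ℤ) : s.lr.kind j = s.kind (-j) := by
  have h1 : ∀ j, s.lr.RightPhase j ↔ s.LeftPhase (-j) := fun j => by
    simp only [RightPhase, LeftPhase, lr, show -1 - j = -j - 1 by ring]
  have h2 : ∀ j, s.lr.LeftPhase j ↔ s.RightPhase (-j) := fun j => by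
    simp only [RightPhase, LeftPhase, lr, show -1 - (j - 1) = -j by ring]
  have h3 : ∀ k, s.lr.SameCol (j - k) (j + k) ↔ s.SameCol (-j - k) (-j + k) := fun k => by
    rw [sameCol_comm]
    simp only [SameCol, lr, show -(j - k) = -j + k by ring, show -(j + k) = -j - k by ring]
  refine kind_congr ?_ (h3 _) (h3 _) (h3 _)
  simp only [Phased, h1, h2, show -(j - 1) = -j + 1 by ring, show -(j + 1) = -j - 1 by ring]
  rw [exactlyOne_rev, and_comm, exactlyOne_rev]

theorem kind_recolor (s : Strip) {f : ℕ → ℕ} (hf : f.Injective) (j : ℤ) :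
    (s.recolor f).kind j = s.kind j := by
  have h1 : ∀ j, (s.recolor f).RightPhase j ↔ s.RightPhase j := fun j => by
    simp only [RightPhase, recolor, hf.eq_iff]
  have h2 : ∀ j, (s.recolor f).LeftPhase j ↔ s.LeftPhase j := fun j => by
    simp only [LeftPhase, recolor, hf.eq_iff]
  have h3 : ∀ a b, (s.recolor f).SameCol a b ↔ s.SameCol a b := fun a b => by
    simp only [SameCol, recolor, hf.eq_iff]
  exact kind_congr (by simp only [Phased, h1, h2]) (h3 _ _) (h3 _ _) (h3 _ _)

theorem kind_shift (s : Strip) (k j : ℤ) : (s.shift k).kind j = s.kind (j + k) := by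
  have h1 : ∀ j, (s.shift k).RightPhase j ↔ s.RightPhase (j + k) := fun j => Iff.rfl
  have h2 : ∀ j, (s.shift k).LeftPhase j ↔ s.LeftPhase (j + k) := fun j => by
    simp only [LeftPhase, shift, add_sub_right_comm]
  have h3 : ∀ a b, (s.shift k).SameCol a b ↔ s.SameCol (a + k) (b + k) := fun a b => Iff.rfl
  have e1 : ∀ a : ℤ, j - a + k = j + k - a := fun a => by ring
  have e2 : ∀ a : ℤ, j + a + k = j + k + a := fun a => by ring
  refine kind_congr ?_ ?_ ?_ ?_ <;> simp only [Phased, h1, h2, h3, e1, e2]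

theorem uniform_recolor (s : Strip) {f : ℕ → ℕ} (hf : f.Injective) :
    (s.recolor f).Uniform ↔ s.Uniform := by
  simp only [Uniform, kind_recolor s hf]

/-- A symmetry of the centre column. -/
def act (k : ZMod 6) (b c : Bool) (s : Strip) : Strip :=
  let t := s.rot k
  let t := if b then t.refl else t
  if c then t.lr else t

theorem Valid.act {s : Strip} (hs : s.Valid) (k : ZMod 6) (b c : Bool) : (s.act k b c).Valid := by
  cases b <;> cases c <;> simp only [Strip.act]
  exacts [hs.rot k, (hs.rot k).lr, (hs.rot k).refl, (hs.rot k).refl.lr]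

theorem uniform_act (s : Strip) (k : ZMod 6) (b c : Bool) :
    (s.act k b c).Uniform ↔ s.Uniform := by
  cases b <;> cases c <;> simp [act, Uniform, kind_lr, kind_refl, kind_rot]
  all_goals exact and_left_comm

end Strip

/-! ### Evaluation of the type -/

def all6 (p : ℕ → Bool) : Bool := p 0 && (p 1 && (p 2 && (p 3 && (p 4 && p 5))))

def colV (f : ℕ → ℕ) (j i : ℕ) : ℕ := f (12 * j + 2 * (i % 6))

def colH (f : ℕ → ℕ) (j i : ℕ) : ℕ := f (12 * j + 2 * (i % 6) + 1)

def rightPhaseF (f : ℕ → ℕ) (j : ℕ) : Bool :=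
  -- Rows are taken mod 6, so `i + 4` stands for `i - 2`.
  all6 fun i => Nat.beq (colH f j i) (colV f j (i + 1)) || Nat.beq (colH f j i) (colV f j (i + 4))

def leftPhaseF (f : ℕ → ℕ) (j : ℕ) : Bool :=
  all6 fun i => Nat.beq (colH f (j - 1) i) (colV f j (i + 1)) ||
    Nat.beq (colH f (j - 1) i) (colV f j (i + 4))

def sameColF (f : ℕ → ℕ) (j k : ℕ) : Bool := all6 fun i => Nat.beq (colV f j i) (colV f k i)

def exactlyOneF (a b c : Bool) : Bool :=
  (a && (!b && !c)) || ((!a && (b && !c)) || (!a && (!b && c)))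

def phasedF (f : ℕ → ℕ) (j : ℕ) : Bool :=
  exactlyOneF (rightPhaseF f (j - 1)) (rightPhaseF f j) (rightPhaseF f (j + 1)) &&
    exactlyOneF (leftPhaseF f (j - 1)) (leftPhaseF f j) (leftPhaseF f (j + 1))

def kindF (f : ℕ → ℕ) (j : ℕ) : ℕ :=
  cond (phasedF f j) 1
    (cond (sameColF f (j - 2) (j + 2) && !sameColF f (j - 1) (j + 1)) 2
      (cond (sameColF f (j - 3) (j + 3) && !sameColF f (j - 1) (j + 1)) 3 0))

def uniformF (f : ℕ → ℕ) : Bool :=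
  Nat.beq (kindF f 7) (kindF f 8) && (Nat.beq (kindF f 9) (kindF f 8) && !Nat.beq (kindF f 8) 0)

theorem colV_congr {f g : ℕ → ℕ} (h : ∀ e, 48 ≤ e → e < 156 → f e = g e) {j : ℕ}
    (i : ℕ) (h1 : 4 ≤ j) (h2 : j ≤ 12) : colV f j i = colV g j i :=
  h _ (by omega) (by omega)

theorem colH_congr {f g : ℕ → ℕ} (h : ∀ e, 48 ≤ e → e < 156 → f e = g e) {j : ℕ}
    (i : ℕ) (h1 : 4 ≤ j) (h2 : j ≤ 12) : colH f j i = colH g j i :=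
  h _ (by omega) (by omega)

theorem kindF_congr {f g : ℕ → ℕ} (h : ∀ e, 48 ≤ e → e < 156 → f e = g e) {j : ℕ}
    (h1 : 7 ≤ j) (h2 : j ≤ 9) : kindF f j = kindF g j := by
  have r : ∀ j, 5 ≤ j → j ≤ 11 → rightPhaseF f j = rightPhaseF g j := fun j h1 h2 => by
    simp only [rightPhaseF, colV_congr h _ (show 4 ≤ j by omega) (show j ≤ 12 by omega),
      colH_congr h _ (show 4 ≤ j by omega) (show j ≤ 12 by omega)]
  have l : ∀ j, 5 ≤ j → j ≤ 11 → leftPhaseF f j = leftPhaseF g j := fun j h1 h2 => by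
    simp only [leftPhaseF, colV_congr h _ (show 4 ≤ j by omega) (show j ≤ 12 by omega),
      colH_congr h _ (show 4 ≤ j - 1 by omega) (show j - 1 ≤ 12 by omega)]
  have t : ∀ j k, 4 ≤ j → k ≤ 12 → j ≤ k → sameColF f j k = sameColF g j k :=
    fun j k h1 h2 h3 => by
    simp only [sameColF, colV_congr h _ h1 (show j ≤ 12 by omega),
      colV_congr h _ (show 4 ≤ k by omega) h2]
  simp only [kindF, phasedF, r j (by omega) (by omega), r (j - 1) (by omega) (by omega),
    r (j + 1) (by omega) (by omega), l j (by omega) (by omega), l (j - 1) (by omega) (by omega),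
    l (j + 1) (by omega) (by omega), t (j - 1) (j + 1) (by omega) (by omega) (by omega),
    t (j - 2) (j + 2) (by omega) (by omega) (by omega),
    t (j - 3) (j + 3) (by omega) (by omega) (by omega)]

/-- The kinds at columns 7, 8, 9 read only columns 4 to 12, that is edges 48 to 155. This determines
how far the search has to color. -/
theorem uniformF_congr {f g : ℕ → ℕ} (h : ∀ e, 48 ≤ e → e < 156 → f e = g e) :
    uniformF f = uniformF g := by
  simp only [uniformF, kindF_congr h (le_refl 7) (by omega),
    kindF_congr h (show 7 ≤ 8 by omega) (by omega), kindF_congr h (show 7 ≤ 9 by omega) le_rfl]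

theorem colV_code (s : Strip) (j i : ℕ) : colV (code s) j i = s.V i (j - 8) := by
  have h : 12 * j + 2 * (i % 6) = 2 * (6 * j + i % 6) := by ring
  have h1 : ((6 * j + i % 6 : ℕ) : ZMod 6) = i := cast_zmod_eq (by omega)
  have h2 : (6 * j + i % 6) / 6 = j := by omega
  rw [colV, h, code_even]
  simp only [vert, h1, h2]

theorem colH_code (s : Strip) (j i : ℕ) : colH (code s) j i = s.H i (j - 8) := by
  have h : 12 * j + 2 * (i % 6) = 2 * (6 * j + i % 6) := by ring
  have h1 : ((6 * j + i % 6 : ℕ) : ZMod 6) = i := cast_zmod_eq (by omega)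
  have h2 : (6 * j + i % 6) / 6 = j := by omega
  rw [colH, h, code_odd]
  simp only [vert, h1, h2]

theorem all6_iff {p : ℕ → Bool} {q : ZMod 6 → Prop} (h : ∀ i : ℕ, p i = true ↔ q i) :
    all6 p = true ↔ ∀ i, q i := by
  have : (∀ i, q i) ↔ ∀ i : Fin 6, q ((i : ℕ) : ZMod 6) := by
    constructor
    · exact fun h i => h _
    · intro h i
      have := h ⟨i.val, ZMod.val_lt i⟩
      simpa using this
  rw [this]
  simp only [Fin.forall_fin_succ, all6, Bool.and_eq_true, h]
  simp

theorem nat_beq_iff {a b : ℕ} : Nat.beq a b = true ↔ a = b := ⟨Nat.eq_of_beq_eq_true, by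
  rintro rfl; exact Nat.beq_refl a⟩

theorem rightPhaseF_code (s : Strip) (j : ℕ) :
    rightPhaseF (code s) j = true ↔ s.RightPhase (j - 8) := by
  refine all6_iff fun i => ?_
  have : (4 : ZMod 6) = -2 := by decide
  simp only [colH_code, colV_code, Bool.or_eq_true, nat_beq_iff]
  push_cast
  rw [this, ← sub_eq_add_neg]

theorem leftPhaseF_code (s : Strip) {j : ℕ} (hj : 1 ≤ j) :
    leftPhaseF (code s) j = true ↔ s.LeftPhase (j - 8) := by
  refine all6_iff fun i => ?_
  have : (4 : ZMod 6) = -2 := by decide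
  have h' : ((j - 1 : ℕ) : ℤ) - 8 = j - 8 - 1 := by omega
  simp only [colH_code, colV_code, Bool.or_eq_true, nat_beq_iff]
  push_cast
  rw [this, ← sub_eq_add_neg, h']

theorem sameColF_code (s : Strip) (j k : ℕ) :
    sameColF (code s) j k = true ↔ s.SameCol (j - 8) (k - 8) := by
  refine all6_iff fun i => ?_
  simp only [colV_code, nat_beq_iff]

theorem exactlyOneF_iff {a b c : Bool} {p q r : Prop} (h1 : a = true ↔ p) (h2 : b = true ↔ q)
    (h3 : c = true ↔ r) : exactlyOneF a b c = true ↔ ExactlyOne p q r := by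
  rw [ExactlyOne, ← h1, ← h2, ← h3]
  cases a <;> cases b <;> cases c <;> simp [exactlyOneF]

theorem kindF_code (s : Strip) {j : ℕ} (hj : 4 ≤ j) : kindF (code s) j = s.kind (j - 8) := by
  have c1 : ∀ k : ℕ, k ≤ 4 → ((j - k : ℕ) : ℤ) - 8 = j - 8 - k := fun k hk => by omega
  have c2 : ∀ k : ℕ, ((j + k : ℕ) : ℤ) - 8 = j - 8 + k := fun k => by omega
  have h1 : phasedF (code s) j = true ↔ s.Phased (j - 8) := by
    rw [phasedF, Bool.and_eq_true]
    refine and_congr (exactlyOneF_iff ?_ ?_ ?_) (exactlyOneF_iff ?_ ?_ ?_)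
    · rw [rightPhaseF_code, c1 1 (by omega)]; rfl
    · rw [rightPhaseF_code]
    · rw [rightPhaseF_code, c2 1]; rfl
    · rw [leftPhaseF_code s (by omega), c1 1 (by omega)]; rfl
    · rw [leftPhaseF_code s (by omega)]
    · rw [leftPhaseF_code s (by omega), c2 1]; rfl
  have h2 : ∀ k : ℕ, k ≤ 4 → (sameColF (code s) (j - k) (j + k) = true ↔
      s.SameCol (j - 8 - k) (j - 8 + k)) := fun k hk => by
    rw [sameColF_code, c1 k hk, c2 k]
  have e1 := h2 1 (by omega)
  have e2 := h2 2 (by omega)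
  have e3 := h2 3 (by omega)
  push_cast at e1 e2 e3
  have e : ∀ {a b : Bool} {p q : Prop}, (a = true ↔ p) → (b = true ↔ q) →
      ((a && !b) = true ↔ p ∧ ¬ q) := by
    intro a b p q h h'
    rw [← h, ← h']
    simp
  simp only [kindF, cond_eq_ite]
  classical exact if_congr h1 rfl (if_congr (e e2 e1) rfl (if_congr (e e3 e1) rfl rfl))

theorem uniformF_code (s : Strip) : uniformF (code s) = true ↔ s.Uniform := by
  simp only [uniformF, Uniform, Bool.and_eq_true, nat_beq_iff, Bool.not_eq_true',
    kindF_code s (show 4 ≤ 7 by omega), kindF_code s (show 4 ≤ 8 by omega),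
    kindF_code s (show 4 ≤ 9 by omega)]
  norm_num
  intro _ _
  rw [← not_iff_not, Bool.not_eq_false, nat_beq_iff, not_not]

end StarSearch

/-! ### Soundness of the search and of its starting positions -/

namespace StarSearch

open Strip

/-! ### Soundness of the search -/

/-- All colorings with the invariant are uniform. -/
def Cov (D A used : ℕ) : Prop := ∀ s : Strip, s.Valid → Inv s used D A → s.Uniform

theorem code_recolor (s : Strip) (f : ℕ → ℕ) (e : ℕ) : code (s.recolor f) e = f (code s e) := by
  unfold code; split_ifs <;> rfl

theorem Asg.recolor {s : Strip} {used A : ℕ} (h : Asg s used A) {f : ℕ → ℕ}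
    (hf : ∀ x, x < used → f x = x) : Asg (s.recolor f) used A := by
  constructor
  · intro e x h1 h2 h3 h4
    obtain ⟨h5, h6⟩ := h.edge e x h1 h2 h3 h4
    exact ⟨by rw [code_recolor, h5, hf x h6], h6⟩
  · intro v x h1 h2
    obtain ⟨⟨d, h5⟩, h6⟩ := h.vertex v x h1 h2
    refine ⟨⟨d, ?_⟩, h6⟩
    have : (s.recolor f).col (vert v) d = f (s.col (vert v) d) := by cases d <;> rfl
    rw [this, h5, hf x h6]

theorem Dom.recolor {s : Strip} {used D : ℕ} (hs : s.Valid) (h : Dom s used D) {f : ℕ → ℕ}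
    (hf : ∀ x, x < used → f x = x) (hf' : ∀ x, used ≤ x → x < 6 → used ≤ f x ∧ f x < 6) :
    Dom (s.recolor f) used D := by
  intro e h1 h2 y hy ha
  refine h e h1 h2 y hy ?_
  rw [code_recolor] at ha
  have h6 := Valid.code_lt hs e
  rcases lt_or_ge (code s e) used with hu | hu
  · rw [hf _ hu] at ha
    exact ha
  · have := hf' _ hu h6
    rcases ha with ha | ha
    · exact Or.inr ⟨hu, by omega, by omega⟩
    · exact Or.inr ⟨hu, ha.2.1, ha.2.2⟩

/-- If the color of `e` is beyond the first unused color, exchange the two. Colors below `used` are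
fixed, so the invariant survives, and the search needs to try only one new color. -/
theorem Inv.exists_le {s : Strip} {used D A : ℕ} (hs : s.Valid) (h : Inv s used D A) (e : ℕ) :
    ∃ s' : Strip, s'.Valid ∧ (s'.Uniform → s.Uniform) ∧ Inv s' used D A ∧ code s' e ≤ used := by
  rcases Nat.lt_or_ge used (code s e) with hu | hu
  swap
  · exact ⟨s, hs, id, h, hu⟩
  have h6 := Valid.code_lt hs e
  set f := Equiv.swap used (code s e) with hf
  have hlt : ∀ x, x < used → f x = x := fun x hx =>
    Equiv.swap_apply_of_ne_of_ne (by omega) (by omega)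
  have hcase : ∀ x, f x = x ∨ (x = used ∧ f x = code s e) ∨ (x = code s e ∧ f x = used) := by
    intro x
    rw [hf]
    by_cases h1 : x = used
    · subst h1; simp
    by_cases h2 : x = code s e
    · subst h2; simp
    · exact Or.inl (Equiv.swap_apply_of_ne_of_ne h1 h2)
  refine ⟨s.recolor f, hs.recolor f.injective fun x hx => ?_,
    (uniform_recolor s f.injective).1, ⟨h.dom.recolor hs hlt fun x h1 h2 => ?_,
    h.asg.recolor hlt⟩, ?_⟩
  · have := hcase x
    omega
  · have := hcase x
    omega
  · rw [code_recolor, hf, Equiv.swap_apply_right]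

theorem Cov.branch {D A used e : ℕ} (he : 36 ≤ e) (he' : e < 156)
    (h : ∀ x, x < 6 → x ≤ used → D.testBit (8 * e + x) = true →
      Cov (assignD D A e x) (assignA A e x) (nextUsed x used)) : Cov D A used := by
  intro s hs hi
  obtain ⟨s', hs', hu, hi', hle⟩ := hi.exists_le hs e
  have h6 := Valid.code_lt hs' e
  exact hu (h _ h6 hle (hi'.dom e he he' _ h6 (Or.inl rfl)) s' hs'
    (hi'.assign hs' he he' rfl hle))

/-- All that is required of the heuristic: it returns the leaf test or continues with some edge. If
that edge has no possible color, the conjunction over its colors is empty and the branch closes. -/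
theorem pick_sound {D A : ℕ} {none : Bool} {k : ℕ → Bool} (h : pick D A none k = true) :
    none = true ∨ ∃ e, k e = true := by
  have he : ∀ t, edgeOf t k = true → ∃ e, k e = true := fun t h => by
    simp only [edgeOf, force_eq] at h
    exact ⟨_, h⟩
  unfold pick pickEmpty at h
  rw [sel_eq_ite] at h
  split_ifs at h
  · unfold pickOpen at h
    rw [sel_eq_ite] at h
    split_ifs at h
    · exact Or.inl h
    · unfold pickMin pickRest pickSingle at h
      rw [sel_eq_ite] at h
      split_ifs at h
      · exact Or.inr (he _ h)
      · exact Or.inr (he _ h)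
  · exact Or.inr (he _ h)

theorem enter_eq (ih : ℕ → ℕ → ℕ → Bool) (D A used e x : ℕ) :
    enter ih D A used e x = ih (assignD D A e x) (assignA A e x) (nextUsed x used) := by
  simp only [enter, enterA, enterUsed, force_eq]

/-- Membership in a list of numbers. -/
def NList.Mem (x : ℕ) : NList → Prop
  | .nil => False
  | .cons y l => x = y ∨ NList.Mem x l

theorem mem_colorsOf {y used x : ℕ} (hx : x < 6) (hu : x ≤ used) (hb : y.testBit x = true) :
    (colorsOfForce y used).Mem x := by
  rw [colorsOfForce, force_eq]
  let F : ℕ → NList → NList := fun n => Nat.rec (motive := fun _ => NList → NList)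
    (fun acc => acc) (fun x ih acc =>
      ih (sel (sel (Nat.ble x used) (tb y x) false) (NList.cons x acc) acc)) n
  -- The recursion runs through the colors downwards while accumulating, so an entry once added must
  -- be shown to persist.
  have mono : ∀ n acc, acc.Mem x → (F n acc).Mem x := by
    intro n
    induction n with
    | zero => exact fun acc h => h
    | succ n ih =>
      intro acc h
      refine ih _ ?_
      generalize sel (Nat.ble n used) (tb y n) false = b
      cases b
      · exact h
      · exact Or.inr h
  have main : ∀ n acc, x < n → (F n acc).Mem x := by
    intro n
    induction n with
    | zero => exact fun acc h => absurd h (by omega)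
    | succ n ih =>
      intro acc h
      rcases Nat.lt_or_ge x n with h' | h'
      · exact ih _ h'
      · have : n = x := by omega
        subst this
        refine mono n _ ?_
        have h1 : Nat.ble n used = true := Nat.ble_eq_true_of_le hu
        rw [h1, tb_eq, hb]
        exact Or.inl rfl
  exact main 6 _ hx

theorem expandColors_sound {ih : ℕ → ℕ → ℕ → Bool} {D A used e : ℕ} {l : NList}
    (h : expandColors ih D A used e l = true) {x : ℕ} (hx : l.Mem x) :
    ih (assignD D A e x) (assignA A e x) (nextUsed x used) = true := by
  induction l with
  | nil => exact hx.elim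
  | cons y l ihl =>
    have h' : sel (enter ih D A used e y) (expandColors ih D A used e l) false = true := h
    rw [sel_eq_ite] at h'
    split_ifs at h' with hy
    rcases hx with rfl | hx
    · rwa [enter_eq] at hy
    · exact ihl h' hx

theorem search_sound {leaf : ℕ → Bool}
    (hleaf : ∀ A used (s : Strip), s.Valid → Asg s used A → leaf A = true → s.Uniform) :
    ∀ (fuel D A used : ℕ), search leaf fuel D A used = true → Cov D A used := by
  intro fuel
  induction fuel with
  | zero => exact fun D A used h => absurd (show false = true from h) (by simp)
  | succ n ih =>
    intro D A used h
    have h' : pick D A (leaf A) (expand (search leaf n) D A used) = true := h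
    rcases pick_sound h' with h1 | ⟨e, h1⟩
    · exact fun s hs hi => hleaf A used s hs hi.asg h1
    · unfold expand at h1
      rw [sel_eq_ite] at h1
      split_ifs at h1 with hw
      have hw' : 36 ≤ e ∧ e ≤ 155 := by
        unfold inWindow at hw
        rw [sel_eq_ite] at hw
        split_ifs at hw with hw1
        exact ⟨Nat.le_of_ble_eq_true hw1, Nat.le_of_ble_eq_true hw⟩
      refine Cov.branch hw'.1 (by omega) fun x hx hu hb => ih _ _ _ ?_
      refine expandColors_sound h1 (mem_colorsOf hx hu ?_)
      rw [testBit_fldE, hb]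
      simpa using hx

/-! ### The test of completed colorings -/

/-- The 108 edges from 48 on are those of columns 4 to 12. Testing at the leaf that they are colored
avoids any argument about the order of the search. -/
noncomputable def allSet (A : ℕ) : Bool :=
  Nat.rec (motive := fun _ => ℕ → Bool) (fun _ => true)
    (fun _ ih e => sel (Nat.beq (fldE A e) 0) false (ih (Nat.succ e))) 108 48

noncomputable def leaf (A : ℕ) : Bool := sel (allSet A) (uniformF fun e => idx (fldE A e)) false

theorem allSet_sound {A e : ℕ} (h : allSet A = true) (h1 : 48 ≤ e) (h2 : e < 156) :
    fldE A e ≠ 0 := by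
  have main : ∀ n a, Nat.rec (motive := fun _ => ℕ → Bool) (fun _ => true)
      (fun _ ih e => sel (Nat.beq (fldE A e) 0) false (ih (Nat.succ e))) n a = true →
      a ≤ e → e < a + n → fldE A e ≠ 0 := by
    intro n
    induction n with
    | zero => intro a _ h1 h2; omega
    | succ n ih =>
      intro a h h1 h2
      have h' : sel (Nat.beq (fldE A a) 0) false (Nat.rec (motive := fun _ => ℕ → Bool)
        (fun _ => true) (fun _ ih e => sel (Nat.beq (fldE A e) 0) false (ih (Nat.succ e))) n
          (Nat.succ a)) = true := h
      rw [sel_eq_ite] at h'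
      split_ifs at h' with h0
      rcases Nat.eq_or_lt_of_le h1 with rfl | h3
      · intro h4
        rw [h4] at h0
        exact h0 rfl
      · exact ih _ h' h3 (by omega)
  exact main 108 48 h h1 (by omega)

theorem leaf_sound (A used : ℕ) (s : Strip) (_ : s.Valid) (hA : Asg s used A)
    (h : leaf A = true) : s.Uniform := by
  unfold leaf at h
  rw [sel_eq_ite] at h
  split_ifs at h with h1
  rw [← uniformF_code, ← h]
  exact uniformF_congr fun e h2 h3 => (hA.fldE (by omega) (by omega) (allSet_sound h1 h2 h3)).1

/-! ### Starting positions -/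

/-- The search from a given position. -/
noncomputable def run : ℕ → ℕ → ℕ → Bool := search leaf 200

theorem run_sound {D A used : ℕ} (h : run D A used = true) : Cov D A used :=
  search_sound leaf_sound 200 D A used h

/-- Continue with the color `x` at the edge `e`, if it is possible. -/
noncomputable def tryColor (e x : ℕ) (k : ℕ → ℕ → ℕ → Bool) (D A used : ℕ) : Bool :=
  sel (sel (Nat.ble x used) (tb D (posE e x)) false) (enter k D A used e x) true

/-- Assign colors to edges, and continue. -/
noncomputable def assignSeq (l : Nbs) (k : ℕ → ℕ → ℕ → Bool) : ℕ → ℕ → ℕ → Bool :=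
  Nbs.rec (motive := fun _ => ℕ → ℕ → ℕ → Bool) k (fun e x _ ih D A used => enter ih D A used e x) l

/-- Remove possible colors, and continue. -/
noncomputable def clearThen (M : ℕ) (k : ℕ → ℕ → ℕ → Bool) (D A used : ℕ) : Bool :=
  force (clear D M) fun D => k D A used

/-- The search starting with the colors in `l` and without the colors in `M`. -/
noncomputable def start (l : Nbs) (M : ℕ) (k : ℕ → ℕ → ℕ → Bool) : Bool :=
  assignSeq l (clearThen M k) full 0 0

/-- A set of continuations which together cover all colorings. -/
def Joint (K : Set (ℕ → ℕ → ℕ → Bool)) : Prop :=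
  ∀ D A used, (∀ k ∈ K, k D A used = true) → Cov D A used

theorem joint_run : Joint {run} := fun _ _ _ h => run_sound (h run rfl)

/-- The branches over one edge become separate continuations, so that a large search can be split
into several kernel evaluations. -/
theorem Joint.branch {K : ℕ → Set (ℕ → ℕ → ℕ → Bool)} (hK : ∀ x, Joint (K x)) {e : ℕ}
    (he : 36 ≤ e) (he' : e < 156) : Joint {k | ∃ x < 6, ∃ k' ∈ K x, k = tryColor e x k'} := by
  intro D A used h
  refine Cov.branch he he' fun x hx hu hb => hK x _ _ _ fun k hk => ?_
  have := h _ ⟨x, hx, k, hk, rfl⟩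
  unfold tryColor at this
  rwa [Nat.ble_eq_true_of_le hu, sel_true, tb_eq, posE_eq, hb, sel_true, enter_eq] at this

/-- The number of colors after an assignment. -/
def usedAfter : Nbs → ℕ → ℕ
  | .nil, used => used
  | .cons _ x l, used => usedAfter l (if x = used then used + 1 else used)

/-- `s` has the colors in `l`, where new colors are used in their order. -/
def Extends (s : Strip) : Nbs → ℕ → Prop
  | .nil, _ => True
  | .cons e x l, used => (36 ≤ e ∧ e < 156) ∧ (code s e = x ∧ x ≤ used) ∧
      Extends s l (if x = used then used + 1 else used)

/-- The state reached does not depend on the continuation `k`; hence several continuations can be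
combined from one common position. -/
theorem assignSeq_eq (l : Nbs) (D A used : ℕ) :
    ∃ D' A', (∀ k, assignSeq l k D A used = k D' A' (usedAfter l used)) ∧
      ∀ s : Strip, s.Valid → Inv s used D A → Extends s l used →
        Inv s (usedAfter l used) D' A' := by
  induction l generalizing D A used with
  | nil => exact ⟨D, A, fun _ => rfl, fun s _ h _ => h⟩
  | cons e x l ih =>
    obtain ⟨D', A', h1, h2⟩ := ih (assignD D A e x) (assignA A e x)
      (if x = used then used + 1 else used)
    refine ⟨D', A', fun k => ?_, fun s hs hi he => ?_⟩
    · have : assignSeq (.cons e x l) k D A used = enter (assignSeq l k) D A used e x := rfl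
      rw [this, enter_eq, nextUsed_eq, h1]
      rfl
    · obtain ⟨⟨he1, he2⟩, ⟨he3, he4⟩, he5⟩ := he
      refine h2 s hs ?_ he5
      have := hi.assign hs he1 he2 he3 he4
      rwa [nextUsed_eq] at this

theorem dom_full (s : Strip) : Dom s 0 full := by
  have h : ∀ f < 156, 36 ≤ f → ∀ y < 6, Nat.testBit full (8 * f + y) = true := by
    decide +kernel
  exact fun f h1 h2 y hy _ => h f h2 h1 y hy

theorem asg_zero (s : Strip) : Asg s 0 0 :=
  ⟨fun f x _ _ _ h => by simp at h, fun v x _ h => by simp at h⟩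

theorem uniform_of_start {l : Nbs} {M : ℕ} {K : Set (ℕ → ℕ → ℕ → Bool)} (hK : Joint K)
    (h : ∀ k ∈ K, start l M k = true) {s : Strip} (hs : s.Valid) (hl : Extends s l 0)
    (hM : ∀ f y, 36 ≤ f → f < 156 → y < 6 → M.testBit (8 * f + y) = true →
      ¬ Adm (usedAfter l 0) (code s f) y) : s.Uniform := by
  obtain ⟨D, A, h1, h2⟩ := assignSeq_eq l full 0 0
  have hi := h2 s hs ⟨dom_full s, asg_zero s⟩ hl
  refine hK (clear D M) A (usedAfter l 0) (fun k hk => ?_) s hs ⟨?_, hi.asg⟩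
  · have := h k hk
    rwa [start, h1, clearThen, force_eq] at this
  · intro f hf hf' y hy ha
    rw [testBit_clear, hi.dom f hf hf' y hy ha]
    by_contra hb
    exact hM f y hf hf' hy (by simpa using hb) ha

end StarSearch

/-! ### Reduction to nine centre columns, each split by the color of one side edge -/

namespace StarSearch

open Strip

/-! ### Normalized lists of colors -/

/-- Rename the colors in a list by their order of appearance, starting after those in `seen`. -/
def norm : List ℕ → List ℕ → List ℕ
  | _, [] => []
  | seen, x :: l => seen.idxOf x :: norm (if x ∈ seen then seen else seen ++ [x]) l

/-- `T` completes `seen` to an enumeration of all six colors in order of appearance; the position in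
`T` is the renaming. -/
theorem exists_map_eq_norm (l seen : List ℕ) (hl : ∀ x ∈ l, x < 6) (hn : seen.Nodup)
    (hs : ∀ x ∈ seen, x < 6) :
    ∃ T : List ℕ, seen <+: T ∧ T.Nodup ∧ (∀ x, x ∈ T ↔ x < 6) ∧
      l.map (fun x => T.idxOf x) = norm seen l := by
  induction l generalizing seen with
  | nil =>
    refine ⟨seen ++ (List.range 6).filter (· ∉ seen), List.prefix_append _ _, ?_, ?_, rfl⟩
    · refine List.Nodup.append hn (List.Nodup.filter _ List.nodup_range) ?_
      intro x hx hx'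
      simp at hx'
      exact hx'.2 hx
    · intro x
      simp only [List.mem_append, List.mem_filter, List.mem_range, decide_eq_true_eq]
      constructor
      · rintro (h | h)
        · exact hs x h
        · exact h.1
      · intro h
        tauto
  | cons x l ih =>
    have hx := hl x (by simp)
    obtain ⟨T, h1, h2, h3, h4⟩ := ih (if x ∈ seen then seen else seen ++ [x])
      (fun y hy => hl y (by simp [hy])) (by
        split_ifs with h
        · exact hn
        · exact List.Nodup.append hn (List.nodup_singleton x) (by simpa using h)) (by
        split_ifs with h
        · exact hs
        · intro y hy
          rw [List.mem_append, List.mem_singleton] at hy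
          rcases hy with hy | rfl
          · exact hs y hy
          · exact hx)
    refine ⟨T, ?_, h2, h3, ?_⟩
    · split_ifs at h1 with h
      · exact h1
      · exact (List.prefix_append _ _).trans h1
    · rw [List.map_cons, h4, norm]
      congr 1
      obtain ⟨T', rfl⟩ := h1
      split_ifs with h
      · rw [List.idxOf_append_of_mem h]
      · rw [List.idxOf_append_of_mem (by simp), List.idxOf_append_of_notMem h]
        simp [List.idxOf_eq_length h]

theorem exists_injective_norm {l : List ℕ} (hl : ∀ x ∈ l, x < 6) :
    ∃ f : ℕ → ℕ, f.Injective ∧ (∀ x, x < 6 → f x < 6) ∧ l.map f = norm [] l := by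
  obtain ⟨T, -, h2, h3, h4⟩ := exists_map_eq_norm l [] hl List.nodup_nil (by simp)
  have hlen : T.length = 6 := by
    rw [← List.toFinset_card_of_nodup h2]
    have : T.toFinset = Finset.range 6 := by ext x; simp [h3]
    rw [this, Finset.card_range]
  have hlt : ∀ x, x < 6 → T.idxOf x < 6 := fun x hx => by
    have := List.idxOf_lt_length_of_mem ((h3 x).2 hx)
    omega
  refine ⟨fun x => if x < 6 then T.idxOf x else x, ?_, ?_, ?_⟩
  · intro x y hxy
    dsimp only at hxy
    split_ifs at hxy with hx hy hy
    · exact (List.idxOf_inj ((h3 x).2 hx)).1 hxy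
    · have := hlt x hx
      omega
    · have := hlt y hy
      omega
    · exact hxy
  · intro x hx
    dsimp only
    rw [if_pos hx]
    exact hlt x hx
  · rw [← h4]
    refine List.map_congr_left fun x hx => ?_
    rw [if_pos (hl x hx)]

/-- Two colors not used so far receive the same new name. This matches the second alternative of
`Adm`. -/
theorem norm_append_congr {l seen : List ℕ} {y z : ℕ} (hy : y ∉ seen) (hz : z ∉ seen)
    (hy' : y ∉ l) (hz' : z ∉ l) : norm seen (l ++ [y]) = norm seen (l ++ [z]) := by
  induction l generalizing seen with
  | nil =>
    simp only [List.nil_append, norm]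
    rw [List.idxOf_eq_length hy, List.idxOf_eq_length hz]
  | cons x l ih =>
    simp only [List.mem_cons, not_or] at hy' hz'
    simp only [List.cons_append, norm]
    congr 1
    refine ih ?_ ?_ hy'.2 hz'.2
    · split_ifs
      · exact hy
      · simp [hy, hy'.1]
    · split_ifs
      · exact hz
      · simp [hz, hz'.1]

/-- All normalized lists of length `n`, starting after `u` colors. -/
def normalLists : ℕ → ℕ → List (List ℕ)
  | 0, _ => [[]]
  | n + 1, u => (List.range (u + 1)).flatMap fun x =>
      (normalLists n (if x = u then u + 1 else u)).map (x :: ·)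

theorem norm_mem (l seen : List ℕ) : norm seen l ∈ normalLists l.length seen.length := by
  induction l generalizing seen with
  | nil => simp [norm, normalLists]
  | cons x l ih =>
    simp only [norm, List.length_cons, normalLists, List.mem_flatMap, List.mem_range, List.mem_map]
    refine ⟨seen.idxOf x, Nat.lt_succ_of_le List.idxOf_le_length, _, ?_, rfl⟩
    have := ih (if x ∈ seen then seen else seen ++ [x])
    by_cases h : x ∈ seen
    · rw [if_pos h] at this ⊢
      rwa [if_neg (List.idxOf_lt_length_of_mem h).ne]
    · rw [if_neg h] at this ⊢
      rw [if_pos (List.idxOf_eq_length h)]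
      simpa using this

/-! ### The centre column -/

namespace Strip

/-- The colors of the edges in column `0`. -/
def column (s : Strip) : List ℕ := [s.V 0 0, s.V 1 0, s.V 2 0, s.V 3 0, s.V 4 0, s.V 5 0]

/-- The color of the edge at row `i` to the right (`t = true`) or left of column `0`. -/
def side (s : Strip) (t : Bool) (i : ZMod 6) : ℕ := s.H i (if t then 0 else -1)

end Strip

/-- The action of the symmetries on a column. -/
def permCol (k : ZMod 6) (b : Bool) (l : List ℕ) : List ℕ :=
  (List.range 6).map fun i => l.getD ((if b then 5 - i + k.val else i + k.val) % 6) 0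

/-- The action of the symmetries on rows. -/
def permRow (k : ZMod 6) (b : Bool) (i : ZMod 6) : ZMod 6 := if b then -i + k else i + k

theorem column_act (s : Strip) (k : ZMod 6) (b c : Bool) :
    (s.act k b c).column = permCol k b s.column := by
  fin_cases k <;> cases b <;> cases c <;> rfl

theorem side_act (s : Strip) (k : ZMod 6) (b c t : Bool) (i : ZMod 6) :
    (s.act k b c).side t i = s.side (xor t c) (permRow k b i) := by
  cases b <;> cases c <;> cases t <;> rfl

theorem column_recolor (s : Strip) (f : ℕ → ℕ) : (s.recolor f).column = s.column.map f := rfl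

theorem side_recolor (s : Strip) (f : ℕ → ℕ) (t : Bool) (i : ZMod 6) :
    (s.recolor f).side t i = f (s.side t i) := rfl

theorem mem_column_lt {s : Strip} (hs : s.Valid) {x : ℕ} (hx : x ∈ s.column) : x < 6 := by
  simp only [Strip.column, List.mem_cons, List.not_mem_nil, or_false] at hx
  have : ∀ i, s.V i 0 < 6 := fun i => hs.lt (i, 0) .U
  rcases hx with rfl | rfl | rfl | rfl | rfl | rfl <;> exact this _

/-- The star condition within a column. -/
def starCol (l : List ℕ) : Bool :=
  all6 fun i => l.getD (i % 6) 0 != l.getD ((i + 1) % 6) 0 &&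
    !(l.getD (i % 6) 0 == l.getD ((i + 2) % 6) 0 && l.getD ((i + 1) % 6) 0 == l.getD ((i + 3) % 6) 0)

theorem starCol_column {s : Strip} (hs : s.Valid) : starCol s.column = true := by
  have h1 : ∀ i, s.V i 0 ≠ s.V (i + 1) 0 := fun i => by
    have := hs.proper (i + 1, 0) .D .U (by simp)
    simpa [col] using this
  have h2 : ∀ i, ¬ (s.V i 0 = s.V (i + 2) 0 ∧ s.V (i + 1) 0 = s.V (i + 3) 0) := fun i h => by
    -- Four consecutive vertical edges from row `i` have their middle vertex in row `i + 2`.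
    refine hs.star (i + 2, 0) .D .U (by simp) ⟨⟨.D, ?_⟩, ⟨.U, ?_⟩⟩
    · simp only [col, nbr]
      rw [← h.1]
      congr 1
      ring
    · simp only [col, nbr]
      rw [show i + 2 - 1 = i + 1 by ring, h.2]
      congr 1
      ring
  have key : ∀ a b c d : ℕ, a ≠ b → ¬ (a = c ∧ b = d) →
      (a != b && !(a == c && b == d)) = true := by
    intro a b c d hab h
    simp only [bne_iff_ne, ne_eq, Bool.and_eq_true, Bool.not_eq_true', Bool.and_eq_false_iff,
      beq_eq_false_iff_ne]
    tauto
  unfold starCol all6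
  simp only [Bool.and_eq_true]
  exact ⟨Bool.and_eq_true _ _ ▸ key _ _ _ _ (h1 0) (h2 0),
    Bool.and_eq_true _ _ ▸ key _ _ _ _ (h1 1) (h2 1),
    Bool.and_eq_true _ _ ▸ key _ _ _ _ (h1 2) (h2 2),
    Bool.and_eq_true _ _ ▸ key _ _ _ _ (h1 3) (h2 3),
    Bool.and_eq_true _ _ ▸ key _ _ _ _ (h1 4) (h2 4),
    Bool.and_eq_true _ _ ▸ key _ _ _ _ (h1 5) (h2 5)⟩

/-- The columns up to symmetry. -/
def columnTypes : List (List ℕ) :=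
  [[0, 1, 0, 2, 0, 3], [0, 1, 0, 2, 1, 2], [0, 1, 0, 2, 1, 3], [0, 1, 2, 0, 1, 3],
    [0, 1, 2, 0, 3, 4], [0, 1, 0, 2, 3, 2], [0, 1, 0, 2, 3, 4], [0, 1, 2, 0, 1, 2],
    [0, 1, 2, 3, 4, 5]]

/-- Normalized lists of length 6 encode the 203 set partitions of the six edges, so this is a small
finite check. -/
theorem exists_columnType : ∀ l ∈ normalLists 6 0, starCol l = true →
    ∃ k : ZMod 6, ∃ b, norm [] (permCol k b l) ∈ columnTypes := by
  decide +kernel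

theorem exists_norm_column {s : Strip} (hs : s.Valid) :
    ∃ s' : Strip, s'.Valid ∧ (s'.Uniform → s.Uniform) ∧ s'.column = norm [] s.column := by
  obtain ⟨f, hf, h6, h⟩ := exists_injective_norm fun x (hx : x ∈ s.column) => mem_column_lt hs hx
  exact ⟨s.recolor f, hs.recolor hf h6, (uniform_recolor s hf).1, h⟩

theorem exists_column_mem {s : Strip} (hs : s.Valid) :
    ∃ s' : Strip, s'.Valid ∧ (s'.Uniform → s.Uniform) ∧ s'.column ∈ columnTypes := by
  obtain ⟨s1, hs1, hu1, h1⟩ := exists_norm_column hs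
  have hm : s1.column ∈ normalLists 6 0 := h1 ▸ norm_mem s.column []
  obtain ⟨k, b, h⟩ := exists_columnType _ hm (starCol_column hs1)
  obtain ⟨s2, hs2, hu2, h2⟩ := exists_norm_column (hs1.act k b false)
  exact ⟨s2, hs2, fun h => hu1 ((uniform_act s1 k b false).1 (hu2 h)),
    by rw [h2, column_act]; exact h⟩

/-! ### Splitting by an edge next to the centre column -/

/-- The number of an edge next to the centre column. -/
def sideNo (t : Bool) (i : ZMod 6) : ℕ := if t then 97 + 2 * i.val else 85 + 2 * i.val

theorem code_sideNo (s : Strip) (t : Bool) (i : ZMod 6) : code s (sideNo t i) = s.side t i := by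
  have h : ∀ n : ℕ, vert (6 * n + i.val) = (i, (n : ℤ) - 8) := fun n => by
    have hi := ZMod.val_lt i
    refine Prod.ext ?_ ?_
    · simp only [vert]
      rw [cast_zmod_eq (show (6 * n + i.val) % 6 = i.val % 6 by omega), ZMod.natCast_zmod_val]
    · simp only [vert]
      omega
  cases t
  · have : sideNo false i = 2 * (6 * 7 + i.val) + 1 := by simp [sideNo]; ring
    rw [this, code_odd, h]
    rfl
  · have : sideNo true i = 2 * (6 * 8 + i.val) + 1 := by simp [sideNo]; ring
    rw [this, code_odd, h]
    rfl

/-- The assignments of the colors in `r` to the edges `e, e + 2, …`. -/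
def colSeq : List ℕ → ℕ → Nbs → Nbs
  | [], _, l => l
  | x :: r, e, l => .cons e x (colSeq r (e + 2) l)

/-- The pair of side edge `(t, i)` and color `a` at the column `r`, after a symmetry, is the pair
of side edge `(xor t c, permRow k b i)` and color `y`. -/
def sameLabel (r : List ℕ) (a : ℕ) (k : ZMod 6) (b : Bool) (y : ℕ) : Bool :=
  norm [] (permCol k b r ++ [y]) == r ++ [a]

/-- The pairs equivalent to the side edge `(t, i)` and the color `a`. -/
def orbit (r : List ℕ) (t : Bool) (i : ZMod 6) (a : ℕ) : List (ℕ × ℕ) :=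
  ([false, true].flatMap fun b => [false, true].flatMap fun c => [0, 1, 2, 3, 4, 5].flatMap fun k =>
    ((List.range 6).filter fun y => sameLabel r a k b y).map
      fun y => (sideNo (xor t c) (permRow k b i), y))

noncomputable def orbitMask (l : List (ℕ × ℕ)) : ℕ :=
  l.foldr (fun p m => Nat.lor (bit (posE p.1 p.2)) m) 0

theorem testBit_orbitMask {l : List (ℕ × ℕ)} {i : ℕ} (h : (orbitMask l).testBit i = true) :
    ∃ p ∈ l, i = 8 * p.1 + p.2 := by
  induction l with
  | nil =>
    have : (0 : ℕ).testBit i = true := h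
    simp at this
  | cons p l ih =>
    have h' : (Nat.lor (bit (posE p.1 p.2)) (orbitMask l)).testBit i = true := h
    rw [testBit_lor, testBit_bit, Bool.or_eq_true, posE_eq] at h'
    rcases h' with h | h
    · exact ⟨p, by simp, (of_decide_eq_true h).symm⟩
    · obtain ⟨p', h1, h2⟩ := ih h
      exact ⟨p', by simp [h1], h2⟩

theorem mem_orbit {r : List ℕ} {t : Bool} {i : ZMod 6} {a : ℕ} {p : ℕ × ℕ}
    (h : p ∈ orbit r t i a) : ∃ k b c, p.1 = sideNo (xor t c) (permRow k b i) ∧ p.2 < 6 ∧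
      norm [] (permCol k b r ++ [p.2]) = r ++ [a] := by
  simp only [orbit, List.mem_flatMap, List.mem_map, List.mem_filter, List.mem_range] at h
  obtain ⟨b, -, c, -, k, -, y, ⟨hy, h⟩, rfl⟩ := h
  exact ⟨k, b, c, rfl, hy, by simpa [sameLabel] using h⟩

theorem getD_permCol_lt {r : List ℕ} {u : ℕ} (h0 : 0 < u) (hr : ∀ x ∈ r, x < u) {k : ZMod 6}
    {b : Bool} {x : ℕ} (hx : x ∈ permCol k b r) : x < u := by
  simp only [permCol, List.mem_map] at hx
  obtain ⟨i, -, rfl⟩ := hx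
  rw [List.getD_eq_getElem?_getD]
  rcases h : r[(if b then 5 - i + k.val else i + k.val) % 6]? with _ | y
  · simpa using h0
  · simpa using hr y (List.mem_of_getElem? h)

/-- If the column `r` with the color `a` at the side edge `(t, i)`, and the column `r` without all
the equivalent side edges, force uniformity, then so does the column `r`. -/
theorem uniform_of_column {r : List ℕ} {t : Bool} {i : ZMod 6} {a : ℕ}
    {K L : Set (ℕ → ℕ → ℕ → Bool)} (hK : Joint K) (hL : Joint L)
    (h1 : ∀ k ∈ K, start (colSeq r 96 (.cons (sideNo t i) a .nil)) 0 k = true)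
    (h2 : ∀ k ∈ L, start (colSeq r 96 .nil) (orbitMask (orbit r t i a)) k = true)
    (hr : ∀ s : Strip, s.column = r → Extends s (colSeq r 96 .nil) 0 ∧
      (s.side t i = a → Extends s (colSeq r 96 (.cons (sideNo t i) a .nil)) 0))
    (h0 : 0 < usedAfter (colSeq r 96 .nil) 0)
    (hu : ∀ x ∈ r, x < usedAfter (colSeq r 96 .nil) 0)
    {s : Strip} (hs : s.Valid) (hc : s.column = r) : s.Uniform := by
  have hlt : ∀ t i, s.side t i < 6 := fun t i => hs.lt (i, _) .R
  -- Either some symmetry and renaming bring `s` to the column `r` with color `a` at the chosen side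
  -- edge, or all pairs in the orbit are forbidden and can be removed from the start of the second
  -- search.
  by_cases h : ∃ k b c, norm [] (permCol k b r ++ [s.side (xor t c) (permRow k b i)]) = r ++ [a]
  · obtain ⟨k, b, c, h⟩ := h
    have hs' := hs.act k b c
    obtain ⟨f, hf, h6, h'⟩ := exists_injective_norm
      (l := permCol k b r ++ [s.side (xor t c) (permRow k b i)]) (by
        intro x hx
        rw [← hc, ← column_act s k b c, List.mem_append, List.mem_singleton] at hx
        rcases hx with hx | rfl
        · exact mem_column_lt hs' hx
        · exact hlt _ _)
    rw [h, List.map_append, List.map_singleton] at h'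
    obtain ⟨h3, h4⟩ := List.append_inj' h' rfl
    refine (uniform_act s k b c).1 ((uniform_recolor _ hf).1 ?_)
    refine uniform_of_start hK h1 (hs'.recolor hf h6) ((hr _ ?_).2 ?_) (by simp)
    · rw [column_recolor, column_act, hc, h3]
    · rw [side_recolor, side_act]
      simpa using h4
  · refine uniform_of_start hL h2 hs (hr s hc).1 fun f y hf hf' hy hb ha => h ?_
    obtain ⟨p, hp, he⟩ := testBit_orbitMask hb
    obtain ⟨k, b, c, h3, h4, h5⟩ := mem_orbit hp
    have e1 : f = p.1 := by omega
    have e2 : y = p.2 := by omega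
    refine ⟨k, b, c, ?_⟩
    rw [← code_sideNo, ← h3, ← e1, ← h5, ← e2]
    -- The actual color of `f` may be `y` itself, or both may be unused in the column. In the second
    -- case they normalize alike, so the orbit pair would again be realized.
    rcases ha with ha | ha
    · rw [ha]
    · exact norm_append_congr (by simp) (by simp)
        (fun hm => absurd (getD_permCol_lt h0 hu hm) (by omega))
        (fun hm => absurd (getD_permCol_lt h0 hu hm) (by omega))

end StarSearch

/-! ### The kernel computations and the rigidity of six-colored strips -/

namespace StarSearch

open Strip

/-! ### The computations -/

/-- The coloring `r` of the centre column, together with the color `a` of the side edge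
`(t, i)`, leaves only uniform colorings. -/
noncomputable def searchWith (r : List ℕ) (t : Bool) (i : ZMod 6) (a : ℕ)
    (k : ℕ → ℕ → ℕ → Bool) : Bool :=
  start (colSeq r 96 (.cons (sideNo t i) a .nil)) 0 k

/-- The coloring `r` of the centre column, without any pair equivalent to the color `a` of the side
edge `(t, i)`, leaves only uniform colorings. -/
noncomputable def searchWithout (r : List ℕ) (t : Bool) (i : ZMod 6) (a : ℕ)
    (k : ℕ → ℕ → ℕ → Bool) : Bool :=
  start (colSeq r 96 .nil) (orbitMask (orbit r t i a)) k

/-- Search directly, or first branch on the color of an edge. -/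
def plans : Option ℕ → Set (ℕ → ℕ → ℕ → Bool)
  | none => {run}
  | some e => {k | ∃ x < 6, ∃ k' ∈ ({run} : Set (ℕ → ℕ → ℕ → Bool)), k = tryColor e x k'}

theorem joint_plans {o : Option ℕ} (h : ∀ e ∈ o, 36 ≤ e ∧ e < 156) : Joint (plans o) := by
  cases o with
  | none => exact joint_run
  | some e => exact Joint.branch (fun _ => joint_run) (h e rfl).1 (h e rfl).2

theorem forall_plans_none {p : (ℕ → ℕ → ℕ → Bool) → Prop} (h : p run) : ∀ k ∈ plans none, p k := by
  rintro k rfl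
  exact h

theorem forall_plans_some {p : (ℕ → ℕ → ℕ → Bool) → Prop} {e : ℕ}
    (h : ∀ x < 6, p (tryColor e x run)) : ∀ k ∈ plans (some e), p k := by
  rintro k ⟨x, hx, _, rfl, rfl⟩
  exact h x hx

/-- New colors appear in their order. -/
def ordered : List ℕ → ℕ → Bool
  | [], _ => true
  | x :: l, used => decide (x ≤ used) && ordered l (if x = used then used + 1 else used)

theorem extends_of_column {r : List ℕ} {t : Bool} {i : ZMod 6} {a : ℕ}
    (h : ordered (r ++ [a]) 0 = true) (s : Strip) (hc : s.column = r) :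
    Extends s (colSeq r 96 .nil) 0 ∧
      (s.side t i = a → Extends s (colSeq r 96 (.cons (sideNo t i) a .nil)) 0) := by
  subst hc
  simp only [Strip.column, List.cons_append, List.nil_append, ordered, Bool.and_eq_true,
    decide_eq_true_eq] at h
  obtain ⟨h0, h1, h2, h3, h4, h5, h6, -⟩ := h
  have hi := ZMod.val_lt i
  refine ⟨⟨⟨by norm_num, by norm_num⟩, ⟨rfl, h0⟩, ⟨by norm_num, by norm_num⟩, ⟨rfl, h1⟩,
    ⟨by norm_num, by norm_num⟩, ⟨rfl, h2⟩, ⟨by norm_num, by norm_num⟩, ⟨rfl, h3⟩,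
    ⟨by norm_num, by norm_num⟩, ⟨rfl, h4⟩, ⟨by norm_num, by norm_num⟩, ⟨rfl, h5⟩, trivial⟩,
    fun ha => ⟨⟨by norm_num, by norm_num⟩, ⟨rfl, h0⟩, ⟨by norm_num, by norm_num⟩, ⟨rfl, h1⟩,
    ⟨by norm_num, by norm_num⟩, ⟨rfl, h2⟩, ⟨by norm_num, by norm_num⟩, ⟨rfl, h3⟩,
    ⟨by norm_num, by norm_num⟩, ⟨rfl, h4⟩, ⟨by norm_num, by norm_num⟩, ⟨rfl, h5⟩,
    ?_, ⟨(code_sideNo s t i).trans ha, h6⟩, trivial⟩⟩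
  cases t <;> simp only [sideNo] <;> norm_num <;> omega

/-- For each of the nine columns, two complementary searches: with the chosen side color, and
without all its equivalents. Where a further edge is given, its six colors are evaluated separately.
-/
theorem search_with_010203 : searchWith [0, 1, 0, 2, 0, 3] false 0 2 run = true := by
  decide +kernel

theorem search_without_010203 : searchWithout [0, 1, 0, 2, 0, 3] false 0 2 run = true := by
  decide +kernel

theorem search_with_010212 : searchWith [0, 1, 0, 2, 1, 2] false 2 2 run = true := by
  decide +kernel

theorem search_without_010212 : searchWithout [0, 1, 0, 2, 1, 2] false 2 2 run = true := by
  decide +kernel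

theorem search_with_010213 : ∀ x < 6, searchWith [0, 1, 0, 2, 1, 3] true 3 3 (tryColor 88 x run) = true := by
  intro x hx
  interval_cases x <;> decide +kernel

theorem search_without_010213 : ∀ x < 6, searchWithout [0, 1, 0, 2, 1, 3] true 3 3 (tryColor 84 x run) = true := by
  intro x hx
  interval_cases x <;> decide +kernel

theorem search_with_012013 : searchWith [0, 1, 2, 0, 1, 3] false 5 0 run = true := by
  decide +kernel

theorem search_without_012013 : ∀ x < 6, searchWithout [0, 1, 2, 0, 1, 3] false 5 0 (tryColor 99 x run) = true := by
  intro x hx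
  interval_cases x <;> decide +kernel

theorem search_with_012034 : ∀ x < 6, searchWith [0, 1, 2, 0, 3, 4] true 2 4 (tryColor 99 x run) = true := by
  intro x hx
  interval_cases x <;> decide +kernel

theorem search_without_012034 : searchWithout [0, 1, 2, 0, 3, 4] true 2 4 run = true := by
  decide +kernel

theorem search_with_010232 : searchWith [0, 1, 0, 2, 3, 2] true 2 2 run = true := by
  decide +kernel

theorem search_without_010232 : searchWithout [0, 1, 0, 2, 3, 2] true 2 2 run = true := by
  decide +kernel

theorem search_with_010234 : ∀ x < 6, searchWith [0, 1, 0, 2, 3, 4] true 2 3 (tryColor 88 x run) = true := by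
  intro x hx
  interval_cases x <;> decide +kernel

theorem search_without_010234 : ∀ x < 6, searchWithout [0, 1, 0, 2, 3, 4] true 2 3 (tryColor 101 x run) = true := by
  intro x hx
  interval_cases x <;> decide +kernel

theorem search_with_012012 : searchWith [0, 1, 2, 0, 1, 2] false 2 0 run = true := by
  decide +kernel

theorem search_without_012012 : searchWithout [0, 1, 2, 0, 1, 2] false 2 0 run = true := by
  decide +kernel

theorem search_with_012345 : ∀ x < 6, searchWith [0, 1, 2, 3, 4, 5] false 5 3 (tryColor 84 x run) = true := by
  intro x hx
  interval_cases x <;> decide +kernel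

theorem search_without_012345 : searchWithout [0, 1, 2, 3, 4, 5] false 5 3 run = true := by
  decide +kernel

/-- The only result of the search used later: every valid strip has one nonzero kind on the columns
`-1, 0, 1`. -/
theorem Strip.Valid.uniform {s : Strip} (hs : s.Valid) : s.Uniform := by
  obtain ⟨s', hs', hu, hc⟩ := exists_column_mem hs
  refine hu ?_
  simp only [columnTypes, List.mem_cons, List.not_mem_nil, or_false] at hc
  rcases hc with hc | hc | hc | hc | hc | hc | hc | hc | hc
  · exact uniform_of_column (joint_plans (o := none) (by simp)) (joint_plans (o := none) (by simp))
      (forall_plans_none search_with_010203) (forall_plans_none search_without_010203)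
      (extends_of_column (t := false) (i := 0) (a := 2) (by decide))
      (by decide) (by decide) hs' hc
  · exact uniform_of_column (joint_plans (o := none) (by simp)) (joint_plans (o := none) (by simp))
      (forall_plans_none search_with_010212) (forall_plans_none search_without_010212)
      (extends_of_column (t := false) (i := 2) (a := 2) (by decide))
      (by decide) (by decide) hs' hc
  · exact uniform_of_column (joint_plans (o := some 88) (by simp)) (joint_plans (o := some 84) (by simp))
      (forall_plans_some search_with_010213) (forall_plans_some search_without_010213)
      (extends_of_column (t := true) (i := 3) (a := 3) (by decide))
      (by decide) (by decide) hs' hc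
  · exact uniform_of_column (joint_plans (o := none) (by simp)) (joint_plans (o := some 99) (by simp))
      (forall_plans_none search_with_012013) (forall_plans_some search_without_012013)
      (extends_of_column (t := false) (i := 5) (a := 0) (by decide))
      (by decide) (by decide) hs' hc
  · exact uniform_of_column (joint_plans (o := some 99) (by simp)) (joint_plans (o := none) (by simp))
      (forall_plans_some search_with_012034) (forall_plans_none search_without_012034)
      (extends_of_column (t := true) (i := 2) (a := 4) (by decide))
      (by decide) (by decide) hs' hc
  · exact uniform_of_column (joint_plans (o := none) (by simp)) (joint_plans (o := none) (by simp))
      (forall_plans_none search_with_010232) (forall_plans_none search_without_010232)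
      (extends_of_column (t := true) (i := 2) (a := 2) (by decide))
      (by decide) (by decide) hs' hc
  · exact uniform_of_column (joint_plans (o := some 88) (by simp)) (joint_plans (o := some 101) (by simp))
      (forall_plans_some search_with_010234) (forall_plans_some search_without_010234)
      (extends_of_column (t := true) (i := 2) (a := 3) (by decide))
      (by decide) (by decide) hs' hc
  · exact uniform_of_column (joint_plans (o := none) (by simp)) (joint_plans (o := none) (by simp))
      (forall_plans_none search_with_012012) (forall_plans_none search_without_012012)
      (extends_of_column (t := false) (i := 2) (a := 0) (by decide))
      (by decide) (by decide) hs' hc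
  · exact uniform_of_column (joint_plans (o := some 84) (by simp)) (joint_plans (o := none) (by simp))
      (forall_plans_some search_with_012345) (forall_plans_none search_without_012345)
      (extends_of_column (t := false) (i := 5) (a := 3) (by decide))
      (by decide) (by decide) hs' hc

end StarSearch

/-! ### Periods of six-colored strips, and the impossibility of five colors -/

namespace StarSearch

open Strip

/-! ### Periodic strips -/

/-- Comparing consecutive triples shows that `p` has period 3. A further period not divisible by 3
would make `p` constant, which no triple allows. -/
theorem three_dvd_of_exactlyOne {p : ℤ → Prop} {n : ℤ}
    (h : ∀ j, ExactlyOne (p (j - 1)) (p j) (p (j + 1))) (hn : ∀ j, p (j + n) ↔ p j) : 3 ∣ n := by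
  have h' : ∀ j, ExactlyOne (p j) (p (j + 1)) (p (j + 2)) := fun j => by
    have := h (j + 1)
    rwa [show j + 1 - 1 = j by ring, show j + 1 + 1 = j + 2 by ring] at this
  have h3 : ∀ j, p (j + 3) ↔ p j := fun j => by
    have h1 := h' j
    have h2 := h' (j + 1)
    rw [show j + 1 + 1 = j + 2 by ring, show j + 1 + 2 = j + 3 by ring] at h2
    unfold ExactlyOne at h1 h2
    tauto
  have h4 : ∀ (m : ℕ) j, p (j + 3 * m) ↔ p j := fun m => by
    induction m with
    | zero => intro j; simp
    | succ m ih =>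
      intro j
      rw [show j + 3 * ((m + 1 : ℕ) : ℤ) = j + 3 * m + 3 by push_cast; ring, h3, ih]
  have h5 : ∀ (m j : ℤ), p (j + 3 * m) ↔ p j := fun m j => by
    rcases Int.eq_nat_or_neg m with ⟨a, rfl | rfl⟩
    · exact h4 a j
    · rw [← h4 a (j + 3 * -(a : ℤ)), show j + 3 * -(a : ℤ) + 3 * a = j by ring]
  have h6 : ∀ j, p (j + n % 3) ↔ p j := fun j => by
    rw [← hn j, ← h5 (n / 3) (j + n % 3), show j + n % 3 + 3 * (n / 3) = j + n by omega]
  rcases (by omega : n % 3 = 0 ∨ n % 3 = 1 ∨ n % 3 = 2) with hr | hr | hr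
  · omega
  · have h1 := h6 0
    have h2 := h6 1
    have h3 := h' 0
    rw [hr] at h1 h2
    norm_num at h1 h2 h3
    unfold ExactlyOne at h3
    tauto
  · have h1 := h6 0
    have h2 := h6 1
    have h3 := h' 0
    have h4 := h' 1
    rw [hr] at h1 h2
    norm_num at h1 h2 h3 h4
    unfold ExactlyOne at h3 h4
    tauto

theorem periodic_emod {α : Type*} {v : ℤ → α} {m n : ℤ} (hm : Function.Periodic v m)
    (hn : Function.Periodic v n) : Function.Periodic v (n % m) := by
  rw [Int.emod_def, mul_comm]
  exact hn.sub_period (hm.int_mul (n / m))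

/-- Together with the period 4, a remainder 1, 2 or 3 would yield the period 2. -/
theorem four_dvd_of_periodic {α : Type*} {v : ℤ → α} {n : ℤ} (h4 : Function.Periodic v 4)
    (hn : Function.Periodic v n) (h2 : v 0 ≠ v 2) : 4 ∣ n := by
  have h := periodic_emod h4 hn
  have h0 := h 0
  have h1 := h 1
  have h2' := h 2
  have h3 := h 3
  have h4' := h4 0
  have h5 := h4 1
  rcases (by omega : n % 4 = 0 ∨ n % 4 = 1 ∨ n % 4 = 2 ∨ n % 4 = 3) with hr | hr | hr | hr
  · omega
  all_goals
    rw [hr] at h0 h1 h2' h3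
    norm_num at h0 h1 h2' h3 h4' h5
    simp_all

/-- Together with the period 6, a remainder 1, 2, 4 or 5 would yield the period 2; remainder 3 is
harmless. -/
theorem three_dvd_of_periodic {α : Type*} {v : ℤ → α} {n : ℤ} (h6 : Function.Periodic v 6)
    (hn : Function.Periodic v n) (h2 : ∀ j, v j ≠ v (j + 2)) : 3 ∣ n := by
  have h := periodic_emod h6 hn
  have e0 := h 0
  have e1 := h 1
  have e5 := h 5
  have f0 := h6 0
  have n0 := h2 0
  have n4 := h2 4
  have f1 := h6 1
  have e4 := h 2
  rcases (by omega : n % 6 = 0 ∨ n % 6 = 1 ∨ n % 6 = 2 ∨ n % 6 = 3 ∨ n % 6 = 4 ∨ n % 6 = 5)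
    with hr | hr | hr | hr | hr | hr
  · omega
  · rw [hr] at e0 e1
    norm_num at e0 e1 n0
    exact absurd (e0.symm.trans e1.symm) n0
  · rw [hr] at e0
    norm_num at e0 n0
    exact absurd e0.symm n0
  · omega
  · rw [hr] at e0
    norm_num at e0 n4 f0
    exact absurd (e0.trans f0.symm) n4
  · rw [hr] at e0 e1 e4
    norm_num at e0 e1 e4 f0 f1 n0
    exact absurd (f0.symm.trans (e1.trans (f1.symm.trans e4))) n0

/-- Uniformity around column `0` of every translate makes the kind constant along the whole strip.
-/
theorem Strip.Valid.kind_eq {s : Strip} (hs : s.Valid) (j : ℤ) : s.kind j = s.kind 0 := by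
  have h : ∀ j, s.kind (j + 1) = s.kind j := fun j => by
    have := (hs.shift j).uniform.2.1
    simp only [kind_shift] at this
    rwa [zero_add, add_comm 1 j] at this
  have h1 : ∀ m : ℕ, s.kind m = s.kind 0 := fun m => by
    induction m with
    | zero => simp
    | succ m ih => rw [Nat.cast_succ, h, ih]
  have h2 : ∀ m : ℕ, s.kind (-m) = s.kind 0 := fun m => by
    induction m with
    | zero => simp
    | succ m ih => rw [← h, ← ih]; congr 1; push_cast; ring
  rcases Int.eq_nat_or_neg j with ⟨a, rfl | rfl⟩
  · exact h1 a
  · exact h2 a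

/-- A valid strip with period `n` exists only if `n` is divisible by `3` or `4`. -/
theorem Strip.Valid.dvd_of_periodic {s : Strip} (hs : s.Valid) {n : ℤ}
    (hV : ∀ i j, s.V i (j + n) = s.V i j) (hH : ∀ i j, s.H i (j + n) = s.H i j) :
    3 ∣ n ∨ 4 ∣ n := by
  have h0 : s.kind 0 ≠ 0 := hs.uniform.2.2
  let v : ℤ → ZMod 6 → ℕ := fun j i => s.V i j
  have hv : Function.Periodic v n := fun j => funext fun i => hV i j
  have hc : ∀ a b, s.SameCol a b ↔ v a = v b := fun a b => funext_iff.symm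
  by_cases h1 : s.Phased 0
  · have hk : s.kind 0 = 1 := if_pos h1
    have hp : ∀ j, s.Phased j := fun j => by
      by_contra h
      have := hs.kind_eq j
      rw [hk, kind, if_neg h] at this
      split_ifs at this <;> omega
    refine Or.inl (three_dvd_of_exactlyOne (p := s.RightPhase) (fun j => (hp j).1) fun j => ?_)
    simp only [RightPhase, hV, hH]
  · have hk : s.kind 0 ≠ 1 := by
      rw [kind, if_neg h1]
      split_ifs <;> simp
    have hp : ∀ j, ¬ s.Phased j := fun j h => by
      have := hs.kind_eq j
      rw [kind, if_pos h] at this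
      exact hk this.symm
    by_cases h2 : s.SameCol (0 - 2) (0 + 2) ∧ ¬ s.SameCol (0 - 1) (0 + 1)
    · have hk2 : s.kind 0 = 2 := by rw [kind, if_neg h1, if_pos h2]
      have hq : ∀ j, s.SameCol (j - 2) (j + 2) ∧ ¬ s.SameCol (j - 1) (j + 1) := fun j => by
        by_contra h
        have := hs.kind_eq j
        rw [hk2, kind, if_neg (hp j), if_neg h] at this
        split_ifs at this
        omega
      refine Or.inr (four_dvd_of_periodic (v := v) (fun j => ?_) hv ?_)
      · have := (hc _ _).1 (hq (j + 2)).1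
        rw [show j + 2 - 2 = j by ring, show j + 2 + 2 = j + 4 by ring] at this
        exact this.symm
      · have := mt (hc _ _).2 (hq 1).2
        norm_num at this
        exact this
    · have hq : ∀ j, s.SameCol (j - 3) (j + 3) ∧ ¬ s.SameCol (j - 1) (j + 1) := fun j => by
        have h2' : ¬ (s.SameCol (j - 2) (j + 2) ∧ ¬ s.SameCol (j - 1) (j + 1)) := fun h => by
          have := hs.kind_eq j
          rw [kind, if_neg (hp j), if_pos h, kind, if_neg h1, if_neg h2] at this
          split_ifs at this
          omega
        by_contra h
        have := hs.kind_eq j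
        rw [kind, if_neg (hp j), if_neg h2', if_neg h] at this
        exact h0 this.symm
      refine Or.inl (three_dvd_of_periodic (v := v) (fun j => ?_) hv fun j => ?_)
      · have := (hc _ _).1 (hq (j + 3)).1
        rw [show j + 3 - 3 = j by ring, show j + 3 + 3 = j + 6 by ring] at this
        exact this.symm
      · have := mt (hc _ _).2 (hq (j + 1)).2
        rwa [show j + 1 - 1 = j by ring, show j + 1 + 1 = j + 2 by ring] at this

/-- Five colors do not suffice. -/
theorem Strip.exists_ge_five (s : Strip) (hp : ∀ p d d', d ≠ d' → s.col p d ≠ s.col p d')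
    (hst : ∀ p d d', d ≠ d' →
      ¬ (s.Occurs (nbr p d) (s.col p d') ∧ s.Occurs (nbr p d') (s.col p d))) :
    ∃ p d, 5 ≤ s.col p d := by
  by_contra! hlt
  -- Four distinct colors out of five occur at each vertex; `m` is the missing one.
  have hm : ∀ q, ∃ m, ∀ x < 5, x ≠ m → s.Occurs q x := by
    intro q
    have hsub : ({s.col q .U, s.col q .D, s.col q .R, s.col q .L} : Finset ℕ) ⊆ Finset.range 5 := by
      intro x hx
      simp only [Finset.mem_insert, Finset.mem_singleton] at hx
      rw [Finset.mem_range]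
      rcases hx with rfl | rfl | rfl | rfl <;> exact hlt _ _
    have hcard : ({s.col q .U, s.col q .D, s.col q .R, s.col q .L} : Finset ℕ).card = 4 := by
      rw [Finset.card_insert_of_notMem, Finset.card_insert_of_notMem, Finset.card_pair]
      · exact hp _ _ _ (by simp)
      · simp only [Finset.mem_insert, Finset.mem_singleton, not_or]
        exact ⟨hp _ _ _ (by simp), hp _ _ _ (by simp)⟩
      · simp only [Finset.mem_insert, Finset.mem_singleton, not_or]
        exact ⟨hp _ _ _ (by simp), hp _ _ _ (by simp), hp _ _ _ (by simp)⟩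
    have hone : (Finset.range 5 \ {s.col q .U, s.col q .D, s.col q .R, s.col q .L}).card = 1 := by
      rw [Finset.card_sdiff_of_subset hsub, hcard, Finset.card_range]
    obtain ⟨m, hm⟩ := Finset.card_eq_one.1 hone
    refine ⟨m, fun x hx hne => ?_⟩
    by_contra ho
    have : x ∈ Finset.range 5 \ {s.col q .U, s.col q .D, s.col q .R, s.col q .L} := by
      simp only [Finset.mem_sdiff, Finset.mem_range, Finset.mem_insert, Finset.mem_singleton, not_or]
      exact ⟨hx, fun h => ho ⟨_, h.symm⟩, fun h => ho ⟨_, h.symm⟩, fun h => ho ⟨_, h.symm⟩,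
        fun h => ho ⟨_, h.symm⟩⟩
    rw [hm, Finset.mem_singleton] at this
    exact hne this
  choose m hm using hm
  have key : ∀ d d', d ≠ d' → s.col (0, 0) d' = m (nbr (0, 0) d) ∨
      s.col (0, 0) d = m (nbr (0, 0) d') := by
    intro d d' hd
    by_contra! h
    exact hst (0, 0) d d' hd ⟨hm _ _ (hlt _ _) h.1, hm _ _ (hlt _ _) h.2⟩
  have h1 := key .U .D (by simp)
  have h2 := key .U .R (by simp)
  have h3 := key .U .L (by simp)
  have h4 := key .D .R (by simp)
  have h5 := key .D .L (by simp)
  have h6 := key .R .L (by simp)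
  have p1 := hp (0, 0) .U .D (by simp)
  have p2 := hp (0, 0) .U .R (by simp)
  have p3 := hp (0, 0) .U .L (by simp)
  have p4 := hp (0, 0) .D .R (by simp)
  have p5 := hp (0, 0) .D .L (by simp)
  have p6 := hp (0, 0) .R .L (by simp)
  -- Six pairs are served by four neighbors, so some neighbor serves two pairs, and two edges at the
  -- origin share its missing color.
  rcases h1 with h1 | h1 <;> rcases h2 with h2 | h2 <;> rcases h3 with h3 | h3 <;>
    rcases h4 with h4 | h4 <;> rcases h5 with h5 | h5 <;> rcases h6 with h6 | h6 <;>
    omega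

end StarSearch

/-! ### Star edge colorings as a condition around the middle vertex -/

namespace SimpleGraph

/-! ### A local criterion for star edge colorings -/

section criterion

variable {V α : Type*} {G : SimpleGraph V} (c : G.lineGraph.Coloring α)

/-- The color of an edge given by its endpoints. -/
def edgeColor {u v : V} (h : G.Adj u v) : α := c ⟨s(u, v), h⟩

theorem edgeColor_symm {u v : V} (h : G.Adj u v) : edgeColor c h.symm = edgeColor c h := by
  unfold edgeColor
  congr 2
  exact Sym2.eq_swap

theorem edgeColor_ne {v x y : V} (hx : G.Adj v x) (hy : G.Adj v y) (h : x ≠ y) :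
    edgeColor c hx ≠ edgeColor c hy := by
  refine c.valid ⟨fun he => h ?_, v, ?_⟩
  · have := congrArg Subtype.val he
    simp only [Sym2.eq_iff] at this
    rcases this with h | h
    · exact h.2
    · exact h.2.trans h.1
  · simp

theorem edgeColor_ne' {v x y : V} (hx : G.Adj x v) (hy : G.Adj v y) (h : x ≠ y) :
    edgeColor c hx ≠ edgeColor c hy := by
  rw [← edgeColor_symm c hx]
  exact edgeColor_ne c _ hy h

/-- In a star edge coloring, there is no alternating walk with four edges around a vertex `v`. -/
theorem IsStarEdgeColoring.not_alternating (hc : IsStarEdgeColoring c) {v x y x' y' : V}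
    (hx : G.Adj v x) (hy : G.Adj v y) (hxy : x ≠ y) (hx' : G.Adj x x') (hy' : G.Adj y y') :
    ¬ (edgeColor c hx' = edgeColor c hy ∧ edgeColor c hy' = edgeColor c hx) := by
  rintro ⟨h1, h2⟩
  -- Properness excludes the degenerate coincidences; the only one left is `x' = y'`, which gives a
  -- 4-cycle instead of a path.
  have n1 : x' ≠ v := by
    rintro rfl
    exact edgeColor_ne c hx hy hxy ((edgeColor_symm c hx).symm.trans h1)
  have n2 : y' ≠ v := by
    rintro rfl
    exact edgeColor_ne c hx hy hxy (h2.symm.trans (edgeColor_symm c hy))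
  have n3 : x' ≠ y := by
    rintro rfl
    exact edgeColor_ne c hx'.symm hy.symm hx.ne'
      ((edgeColor_symm c hx').trans (h1.trans (edgeColor_symm c hy).symm))
  have n4 : y' ≠ x := by
    rintro rfl
    exact edgeColor_ne c hy'.symm hx.symm hy.ne'
      ((edgeColor_symm c hy').trans (h2.trans (edgeColor_symm c hx).symm))
  have e1 := edgeColor_symm c hx'
  have e2 := edgeColor_symm c hx
  by_cases n5 : x' = y'
  · subst n5
    let p : G.Walk x' x' := .cons hx'.symm (.cons hx.symm (.cons hy (.cons hy' .nil)))
    refine hc.2 x' p ?_ rfl ⟨edgeColor c hx', edgeColor c hx, ?_⟩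
    · rw [Walk.isCycle_def, Walk.isTrail_def]
      refine ⟨?_, by simp [p], ?_⟩
      · simp [p, n1, n3, n4, hxy, n1.symm, n3.symm, n4.symm, hx.ne', hy.ne]
      · simp [p, hx.ne', hxy, hy.ne, hx'.ne, hy'.ne, n1.symm]
    · intro e he
      simp only [p, Walk.edges_cons, Walk.edges_nil, List.mem_cons, List.not_mem_nil,
        or_false] at he
      rcases he with rfl | rfl | rfl | rfl
      · exact Or.inl e1
      · exact Or.inr e2
      · exact Or.inl h1.symm
      · exact Or.inr h2
  · let p : G.Walk x' y' := .cons hx'.symm (.cons hx.symm (.cons hy (.cons hy' .nil)))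
    refine hc.1 x' y' p ?_ rfl ⟨edgeColor c hx', edgeColor c hx, ?_⟩
    · rw [Walk.isPath_def]
      simp [p, hx.ne', hxy, hy.ne, hx'.ne', hy'.ne, n1, n2.symm, n3, n4.symm, n5]
    · intro e he
      simp only [p, Walk.edges_cons, Walk.edges_nil, List.mem_cons, List.not_mem_nil,
        or_false] at he
      rcases he with rfl | rfl | rfl | rfl
      · exact Or.inl e1
      · exact Or.inr e2
      · exact Or.inl h1.symm
      · exact Or.inr h2

theorem eq_of_alternating {p q r t a b : α} (h1 : p = a ∨ p = b) (h2 : q = a ∨ q = b)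
    (h3 : r = a ∨ r = b) (h4 : t = a ∨ t = b) (h5 : p ≠ q) (h6 : q ≠ r) (h7 : r ≠ t) :
    p = r ∧ q = t := by
  grind

/-- A properly colored walk of four edges in two colors alternates. Read from its middle vertex, it
is the excluded configuration, for a path and for a cycle alike. -/
theorem isStarEdgeColoring_of_not_alternating
    (h : ∀ {v x y x' y' : V} (hx : G.Adj v x) (hy : G.Adj v y) (_ : x ≠ y) (hx' : G.Adj x x')
      (hy' : G.Adj y y'),
      ¬ (edgeColor c hx' = edgeColor c hy ∧ edgeColor c hy' = edgeColor c hx)) :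
    IsStarEdgeColoring c := by
  have key : ∀ {w₀ w₁ w₂ w₃ w₄ : V} (h₁ : G.Adj w₀ w₁) (h₂ : G.Adj w₁ w₂) (h₃ : G.Adj w₂ w₃)
      (h₄ : G.Adj w₃ w₄), w₀ ≠ w₂ → w₁ ≠ w₃ → w₂ ≠ w₄ →
      ¬ IsBichromatic c (.cons h₁ (.cons h₂ (.cons h₃ (.cons h₄ .nil)))) := by
    rintro w₀ w₁ w₂ w₃ w₄ h₁ h₂ h₃ h₄ n1 n2 n3 ⟨a, b, hab⟩
    have c1 : edgeColor c h₁ = a ∨ edgeColor c h₁ = b := hab s(w₀, w₁) (by simp)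
    have c2 : edgeColor c h₂ = a ∨ edgeColor c h₂ = b := hab s(w₁, w₂) (by simp)
    have c3 : edgeColor c h₃ = a ∨ edgeColor c h₃ = b := hab s(w₂, w₃) (by simp)
    have c4 : edgeColor c h₄ = a ∨ edgeColor c h₄ = b := hab s(w₃, w₄) (by simp)
    have d1 := edgeColor_ne' c h₁ h₂ n1
    have d2 := edgeColor_ne' c h₂ h₃ n2
    have d3 := edgeColor_ne' c h₃ h₄ n3
    obtain ⟨e1, e2⟩ := eq_of_alternating c1 c2 c3 c4 d1 d2 d3
    exact h h₂.symm h₃ n2 h₁.symm h₄ ⟨(edgeColor_symm c h₁).trans e1,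
      e2.symm.trans (edgeColor_symm c h₂).symm⟩
  constructor
  · intro u v p hp hl
    match p, hp, hl with
    | .cons h₁ (.cons h₂ (.cons h₃ (.cons h₄ .nil))), hp, _ =>
      rw [Walk.isPath_def] at hp
      simp at hp
      exact key h₁ h₂ h₃ h₄ (by tauto) (by tauto) (by tauto)
  · intro u p hp hl
    match p, hp, hl with
    | .cons h₁ (.cons h₂ (.cons h₃ (.cons h₄ .nil))), hp, _ =>
      have := hp.support_nodup
      simp at this
      exact key h₁ h₂ h₃ h₄ (by tauto) (by tauto) (by tauto)

end criterion

end SimpleGraph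

/-! ### Passing between the torus and its covering strip -/

namespace StarSearch

open Strip SimpleGraph

/-! ### The torus and its strip -/

/-- The product of a 6-cycle and an `(m + 3)`-cycle. -/
abbrev torus (m : ℕ) : SimpleGraph (ZMod 6 × ZMod (m + 3)) :=
  SimpleGraph.boxProd (cycleGraph 6) (cycleGraph (m + 3))

theorem torus_adj {m : ℕ} {p q : ZMod 6 × ZMod (m + 3)} : (torus m).Adj p q ↔
    ((p.1 - q.1 = 1 ∨ q.1 - p.1 = 1) ∧ p.2 = q.2) ∨
      ((p.2 - q.2 = 1 ∨ q.2 - p.2 = 1) ∧ p.1 = q.1) := by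
  exact (boxProd_adj (G := cycleGraph 6) (H := cycleGraph (m + 3)) (x := p) (y := q)).trans <|
    or_congr (and_congr_left' (cycleGraph_adj (n := 4)))
    (and_congr_left' (cycleGraph_adj (n := m + 1)))

/-- The projection of the strip to the torus. -/
def proj (m : ℕ) (p : ZMod 6 × ℤ) : ZMod 6 × ZMod (m + 3) := (p.1, p.2)

theorem proj_nbr (m : ℕ) (p : ZMod 6 × ℤ) (d : Dir) : proj m (nbr p d) = match d with
    | .U => (p.1 + 1, (p.2 : ZMod (m + 3)))
    | .D => (p.1 - 1, (p.2 : ZMod (m + 3)))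
    | .R => (p.1, (p.2 : ZMod (m + 3)) + 1)
    | .L => (p.1, (p.2 : ZMod (m + 3)) - 1) := by
  cases d <;> simp [proj, nbr]

theorem adj_proj (m : ℕ) (p : ZMod 6 × ℤ) (d : Dir) :
    (torus m).Adj (proj m p) (proj m (nbr p d)) := by
  rw [torus_adj, proj_nbr]
  cases d <;> simp [proj]

theorem exists_dir {m : ℕ} {p : ZMod 6 × ℤ} {q : ZMod 6 × ZMod (m + 3)}
    (h : (torus m).Adj (proj m p) q) : ∃ d, q = proj m (nbr p d) := by
  rw [torus_adj] at h
  simp only [proj] at h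
  rcases h with ⟨h | h, h'⟩ | ⟨h | h, h'⟩
  · refine ⟨.D, ?_⟩
    rw [proj_nbr]
    exact Prod.ext (by rw [← h]; simp) h'.symm
  · refine ⟨.U, ?_⟩
    rw [proj_nbr]
    exact Prod.ext (by rw [← h]; simp) h'.symm
  · refine ⟨.L, ?_⟩
    rw [proj_nbr]
    exact Prod.ext h'.symm (by rw [← h]; simp)
  · refine ⟨.R, ?_⟩
    rw [proj_nbr]
    exact Prod.ext h'.symm (by rw [← h]; simp)

theorem proj_surjective (m : ℕ) : Function.Surjective (proj m) := by
  rintro ⟨i, j⟩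
  obtain ⟨k, rfl⟩ := ZMod.intCast_surjective j
  exact ⟨(i, k), rfl⟩

theorem two_ne_zero_zmod (m : ℕ) : (2 : ZMod (m + 3)) ≠ 0 := by
  intro h
  have : ((2 : ℕ) : ZMod (m + 3)) = 0 := by exact_mod_cast h
  rw [ZMod.natCast_eq_zero_iff] at this
  have := Nat.le_of_dvd (by norm_num) this
  omega

/-- The projection is injective on the neighbors of a vertex. This uses that the second cycle has
length at least 3. -/
theorem proj_nbr_ne (m : ℕ) (p : ZMod 6 × ℤ) {d d' : Dir} (h : d ≠ d') :
    proj m (nbr p d) ≠ proj m (nbr p d') := by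
  have h1 : ∀ x : ZMod 6, x + 1 ≠ x - 1 := by decide
  have h2 : ∀ x : ZMod (m + 3), x + 1 ≠ x - 1 := fun x hx => two_ne_zero_zmod m (by
    have : x + 1 - (x - 1) = 0 := by rw [hx, sub_self]
    rw [← this]
    ring)
  have h4 : (1 : ZMod 6) ≠ 0 := by decide
  intro he
  rw [proj_nbr, proj_nbr] at he
  obtain ⟨e1, e2⟩ := Prod.ext_iff.1 he
  cases d <;> cases d' <;> first
    | exact h rfl
    | exact h1 _ e1
    | exact h1 _ e1.symm
    | exact h2 _ e2
    | exact h2 _ e2.symm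
    | exact h4 (by simpa using e1)
    | exact h4 (by simpa using e1.symm)

theorem proj_eq {m : ℕ} {p q : ZMod 6 × ℤ} (h : proj m p = proj m q) :
    ∃ k : ℤ, q = (p.1, p.2 + (m + 3) * k) := by
  have h1 : p.1 = q.1 := (Prod.ext_iff.1 h).1
  have h2 : (p.2 : ZMod (m + 3)) = q.2 := (Prod.ext_iff.1 h).2
  rw [ZMod.intCast_eq_intCast_iff_dvd_sub] at h2
  obtain ⟨k, hk⟩ := h2
  refine ⟨k, Prod.ext h1.symm ?_⟩
  push_cast at hk
  show q.2 = p.2 + (m + 3) * k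
  omega

/-- The strip of an edge coloring of the torus. -/
def lift {m k : ℕ} (c : (torus m).lineGraph.Coloring (Fin k)) : Strip where
  V i j := (edgeColor c (adj_proj m (i, j) .U)).val
  H i j := (edgeColor c (adj_proj m (i, j) .R)).val

theorem edgeColor_congr {V α : Type*} {G : SimpleGraph V} (c : G.lineGraph.Coloring α)
    {u v u' v' : V} (h : G.Adj u v) (h' : G.Adj u' v') (hu : u = u') (hv : v = v') :
    edgeColor c h = edgeColor c h' := by
  subst hu hv
  rfl

theorem col_lift {m k : ℕ} (c : (torus m).lineGraph.Coloring (Fin k)) (p : ZMod 6 × ℤ) (d : Dir) :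
    (lift c).col p d = (edgeColor c (adj_proj m p d)).val := by
  cases d
  · rfl
  · rw [← edgeColor_symm]
    exact congrArg Fin.val (edgeColor_congr c _ _ rfl (by simp [nbr]))
  · rfl
  · rw [← edgeColor_symm]
    exact congrArg Fin.val (edgeColor_congr c _ _ rfl (by simp [nbr]))

theorem lift_lt {m k : ℕ} (c : (torus m).lineGraph.Coloring (Fin k)) (p : ZMod 6 × ℤ) (d : Dir) :
    (lift c).col p d < k := by
  rw [col_lift]
  exact Fin.isLt _

theorem lift_proper {m k : ℕ} (c : (torus m).lineGraph.Coloring (Fin k)) (p : ZMod 6 × ℤ)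
    (d d' : Dir) (h : d ≠ d') : (lift c).col p d ≠ (lift c).col p d' := by
  rw [col_lift, col_lift]
  exact fun h' => edgeColor_ne c _ _ (proj_nbr_ne m p h) (Fin.ext h')

theorem lift_star {m k : ℕ} {c : (torus m).lineGraph.Coloring (Fin k)}
    (hc : IsStarEdgeColoring c) (p : ZMod 6 × ℤ) (d d' : Dir) (h : d ≠ d') :
    ¬ ((lift c).Occurs (nbr p d) ((lift c).col p d') ∧
      (lift c).Occurs (nbr p d') ((lift c).col p d)) := by
  rintro ⟨⟨a, ha⟩, ⟨b, hb⟩⟩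
  rw [col_lift, col_lift] at ha hb
  exact hc.not_alternating c (adj_proj m p d) (adj_proj m p d') (proj_nbr_ne m p h)
    (adj_proj m (nbr p d) a) (adj_proj m (nbr p d') b) ⟨Fin.ext ha, Fin.ext hb⟩

theorem lift_periodic {m k : ℕ} (c : (torus m).lineGraph.Coloring (Fin k)) :
    (∀ i j, (lift c).V i (j + (m + 3 : ℕ)) = (lift c).V i j) ∧
      ∀ i j, (lift c).H i (j + (m + 3 : ℕ)) = (lift c).H i j := by
  have h : ∀ i j, proj m (i, j + (m + 3 : ℕ)) = proj m (i, j) := fun i j => by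
    simp only [proj, Int.cast_add, Int.cast_natCast, ZMod.natCast_self, add_zero]
  refine ⟨fun i j => congrArg Fin.val (edgeColor_congr c _ _ (h i j) (h (i + 1) j)),
    fun i j => congrArg Fin.val (edgeColor_congr c _ _ (h i j) ?_)⟩
  have := h i (j + 1)
  rw [add_right_comm] at this
  exact this

/-- A star edge coloring of the torus needs six colors. -/
theorem six_le_of_star {m k : ℕ} {c : (torus m).lineGraph.Coloring (Fin k)}
    (hc : IsStarEdgeColoring c) : 6 ≤ k := by
  obtain ⟨p, d, h⟩ := (lift c).exists_ge_five (lift_proper c) (lift_star hc)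
  have := lift_lt c p d
  omega

theorem dvd_of_star {m : ℕ} {c : (torus m).lineGraph.Coloring (Fin 6)}
    (hc : IsStarEdgeColoring c) : 3 ∣ m + 3 ∨ 4 ∣ m + 3 := by
  have hs : (lift c).Valid := ⟨lift_lt c, lift_proper c, lift_star hc⟩
  have := hs.dvd_of_periodic (lift_periodic c).1 (lift_periodic c).2
  exact_mod_cast this

/-! ### Colorings of the torus from periodic strips -/

theorem col_add_period {s : Strip} {m : ℕ} (hV : ∀ i j, s.V i (j + (m + 3 : ℕ)) = s.V i j)
    (hH : ∀ i j, s.H i (j + (m + 3 : ℕ)) = s.H i j) (p : ZMod 6 × ℤ) (d : Dir) (k : ℤ) :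
    s.col (p.1, p.2 + (m + 3) * k) d = s.col p d := by
  have hV' : ∀ i j, s.V i (j + (m + 3) * k) = s.V i j := fun i j => by
    have : Function.Periodic (s.V i) ((m + 3 : ℕ) : ℤ) := hV i
    have := this.int_mul k j
    push_cast at this
    rwa [mul_comm] at this
  have hH' : ∀ i j, s.H i (j + (m + 3) * k) = s.H i j := fun i j => by
    have : Function.Periodic (s.H i) ((m + 3 : ℕ) : ℤ) := hH i
    have := this.int_mul k j
    push_cast at this
    rwa [mul_comm] at this
  cases d <;> simp only [col, hV', hH']
  rw [add_sub_right_comm, hH']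

theorem nbr_add (p : ZMod 6 × ℤ) (d : Dir) (k : ℤ) :
    nbr (p.1, p.2 + k) d = ((nbr p d).1, (nbr p d).2 + k) := by
  cases d <;> simp only [nbr, Prod.mk.injEq, true_and] <;> ring

theorem proj_add (m : ℕ) (p : ZMod 6 × ℤ) (k : ℤ) :
    proj m (p.1, p.2 + (m + 3) * k) = proj m p := by
  have : ((m : ZMod (m + 3)) + 3) = 0 := by
    have := ZMod.natCast_self (m + 3)
    push_cast at this
    exact this
  simp [proj, this]

/-- Each torus edge receives the color of an arbitrary lift. Periodicity makes the choice
immaterial, and the conditions at a vertex are those at any vertex above it. -/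
theorem starEdgeColorable_of_strip {m k : ℕ} (s : Strip)
    (hV : ∀ i j, s.V i (j + (m + 3 : ℕ)) = s.V i j)
    (hH : ∀ i j, s.H i (j + (m + 3 : ℕ)) = s.H i j) (hlt : ∀ p d, s.col p d < k)
    (hp : ∀ p d d', d ≠ d' → s.col p d ≠ s.col p d')
    (hst : ∀ p d d', d ≠ d' →
      ¬ (s.Occurs (nbr p d) (s.col p d') ∧ s.Occurs (nbr p d') (s.col p d))) :
    (torus m).StarEdgeColorable k := by
  have hcongr : ∀ p q d d', proj m p = proj m q → proj m (nbr p d) = proj m (nbr q d') →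
      s.col p d = s.col q d' := by
    intro p q d d' h h'
    obtain ⟨t, rfl⟩ := proj_eq h
    rw [nbr_add, proj_add] at h'
    rw [col_add_period hV hH]
    by_cases hd : d = d'
    · rw [hd]
    · exact absurd h' (proj_nbr_ne m p hd)
  have hwd : ∀ p q d d', s(proj m p, proj m (nbr p d)) = s(proj m q, proj m (nbr q d')) →
      s.col p d = s.col q d' := by
    intro p q d d' h
    rw [Sym2.eq_iff] at h
    rcases h with ⟨h1, h2⟩ | ⟨h1, h2⟩
    · exact hcongr p q d d' h1 h2
    -- The same edge may be lifted with its endpoints exchanged.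
    · rw [← s.col_rev q d']
      exact hcongr p (nbr q d') d d'.rev h1 (by rw [nbr_rev, h2])
  have hex : ∀ e : (torus m).edgeSet, ∃ pd : (ZMod 6 × ℤ) × Dir,
      (e : Sym2 (ZMod 6 × ZMod (m + 3))) = s(proj m pd.1, proj m (nbr pd.1 pd.2)) := by
    rintro ⟨e, he⟩
    induction e with
    | _ u v =>
      obtain ⟨p, rfl⟩ := proj_surjective m u
      obtain ⟨d, rfl⟩ := exists_dir (he : (torus m).Adj _ _)
      exact ⟨(p, d), rfl⟩
  choose g hg using hex
  have hgc : ∀ (e : (torus m).edgeSet) p d,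
      (e : Sym2 (ZMod 6 × ZMod (m + 3))) = s(proj m p, proj m (nbr p d)) →
      s.col (g e).1 (g e).2 = s.col p d := fun e p d h => hwd _ _ _ _ ((hg e).symm.trans h)
  let c : (torus m).lineGraph.Coloring (Fin k) :=
    Coloring.mk (fun e => ⟨s.col (g e).1 (g e).2, hlt _ _⟩) (by
      intro e f hef heq
      obtain ⟨hne, x, hx, hx'⟩ := hef
      obtain ⟨p, rfl⟩ := proj_surjective m x
      obtain ⟨e, he⟩ := e
      obtain ⟨f, hf⟩ := f
      have hx1 : proj m p ∈ e := hx
      have hx2 : proj m p ∈ f := hx'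
      obtain ⟨u, rfl⟩ := Sym2.mem_iff_exists.1 hx1
      obtain ⟨v, rfl⟩ := Sym2.mem_iff_exists.1 hx2
      obtain ⟨d, rfl⟩ := exists_dir (he : (torus m).Adj _ _)
      obtain ⟨d', rfl⟩ := exists_dir (hf : (torus m).Adj _ _)
      have h1 := hgc ⟨_, he⟩ p d rfl
      have h2 := hgc ⟨_, hf⟩ p d' rfl
      have h3 := congrArg Fin.val heq
      simp only at h3
      rw [h1, h2] at h3
      refine hp p d d' ?_ h3
      rintro rfl
      exact hne rfl)
  have hcol : ∀ p d (h : (torus m).Adj (proj m p) (proj m (nbr p d))),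
      (edgeColor c h).val = s.col p d := fun p d h => hgc ⟨_, h⟩ p d rfl
  refine ⟨c, isStarEdgeColoring_of_not_alternating c ?_⟩
  intro v x y x' y' hx hy hxy hx' hy'
  obtain ⟨p, rfl⟩ := proj_surjective m v
  obtain ⟨d, rfl⟩ := exists_dir hx
  obtain ⟨d', rfl⟩ := exists_dir hy
  obtain ⟨a, rfl⟩ := exists_dir hx'
  obtain ⟨b, rfl⟩ := exists_dir hy'
  rintro ⟨h1, h2⟩
  have h1 := congrArg Fin.val h1
  have h2 := congrArg Fin.val h2
  rw [hcol, hcol] at h1 h2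
  exact hst p d d' (fun h => hxy (by rw [h])) ⟨⟨a, h1⟩, ⟨b, h2⟩⟩

end StarSearch

/-! ### Explicit colorings with six and seven colors -/

namespace StarSearch

open Strip SimpleGraph

/-! ### Colorings with few types of columns -/

instance : Fintype Dir := ⟨{.U, .D, .R, .L}, fun d => by cases d <;> simp⟩

def lookup (t : List (List ℕ)) (a : ℕ) (i : ZMod 6) : ℕ := (t.getD a []).getD i.val 0

/-- The strip whose columns have the types `w`; column type `a` has the colors in the rows `a` of
the tables `tV` and `tH`. -/
def tableStrip (tV tH : List (List ℕ)) (w : ℤ → ℕ) : Strip where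
  V i j := lookup tV (w j) i
  H i j := lookup tH (w j) i

/-- Four consecutive types of columns. -/
def walk (a b c d : ℕ) (j : ℤ) : ℕ :=
  if j = -2 then a else if j = -1 then b else if j = 0 then c else d

/-- The conditions at the vertices of the column `0`. -/
def GoodAt (k : ℕ) (s : Strip) : Prop :=
  ∀ (i : ZMod 6) (d : Dir), s.col (i, 0) d < k ∧ ∀ d', d ≠ d' → s.col (i, 0) d ≠ s.col (i, 0) d' ∧
    ¬ ((∃ a, s.col (nbr (i, 0) d) a = s.col (i, 0) d') ∧
      ∃ a, s.col (nbr (i, 0) d') a = s.col (i, 0) d)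

instance (k : ℕ) (s : Strip) : Decidable (GoodAt k s) := by
  unfold GoodAt
  infer_instance

/-- The conditions at a vertex involve its own column, the two adjacent ones, and the horizontal
edges leaving the left one to the left. So it suffices to check every chain of four column types
linked by `E`. -/
theorem starEdgeColorable_of_table {k m : ℕ} (tV tH : List (List ℕ)) (E : List (ℕ × ℕ))
    (hE : ∀ x ∈ E, ∀ y ∈ E, x.2 = y.1 → ∀ z ∈ E, y.2 = z.1 →
      GoodAt k (tableStrip tV tH (walk x.1 y.1 z.1 z.2)))
    (w : ℤ → ℕ) (hw : ∀ j, w (j + (m + 3 : ℕ)) = w j) (h : ∀ j, (w j, w (j + 1)) ∈ E) :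
    (torus m).StarEdgeColorable k := by
  have key : ∀ j : ℤ, ∃ s' : Strip, GoodAt k s' ∧
      (∀ i d, (tableStrip tV tH w).col (i, j) d = s'.col (i, 0) d) ∧
      ∀ i d a, (tableStrip tV tH w).col (nbr (i, j) d) a = s'.col (nbr (i, 0) d) a := by
    intro j
    have e1 := h (j - 2)
    have e2 := h (j - 1)
    have e3 := h j
    rw [show j - 2 + 1 = j - 1 by ring] at e1
    rw [show j - 1 + 1 = j by ring] at e2
    refine ⟨_, hE _ e1 _ e2 rfl _ e3 rfl, fun i d => ?_, fun i d a => ?_⟩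
    · cases d <;> simp [col, tableStrip, walk]
    · have : j - 1 - 1 = j - 2 := by ring
      cases d <;> cases a <;> simp [col, nbr, tableStrip, walk, this]
  refine starEdgeColorable_of_strip (tableStrip tV tH w) ?_ ?_ ?_ ?_ ?_
  · intro i j
    simp only [tableStrip, hw]
  · intro i j
    simp only [tableStrip, hw]
  · rintro ⟨i, j⟩ d
    obtain ⟨s', h1, h2, -⟩ := key j
    rw [h2]
    exact (h1 i d).1
  · rintro ⟨i, j⟩ d d' hd
    obtain ⟨s', h1, h2, -⟩ := key j
    rw [h2, h2]
    exact ((h1 i d).2 d' hd).1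
  · rintro ⟨i, j⟩ d d' hd
    obtain ⟨s', h1, h2, h3⟩ := key j
    simp only [Occurs, h2, h3]
    exact ((h1 i d).2 d' hd).2

theorem starEdgeColorable_of_three_dvd {m : ℕ} (h : 3 ∣ m + 3) :
    (torus m).StarEdgeColorable 6 := by
  refine starEdgeColorable_of_table
    -- Vertical edges use the colors 1, 5, 2 and horizontal ones 4, 3, 0, each with period 3; from
    -- column to column the two patterns shift in opposite directions.
    [[1, 5, 2, 1, 5, 2], [2, 1, 5, 2, 1, 5], [5, 2, 1, 5, 2, 1]]
    [[4, 3, 0, 4, 3, 0], [3, 0, 4, 3, 0, 4], [0, 4, 3, 0, 4, 3]]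
    [(0, 1), (1, 2), (2, 0)] (by decide +kernel) (fun j => (j % 3).toNat) ?_ ?_
  · intro j
    congr 1
    omega
  · intro j
    simp only [List.mem_cons, Prod.mk.injEq, List.not_mem_nil, or_false]
    omega

theorem starEdgeColorable_of_four_dvd {m : ℕ} (h : 4 ∣ m + 3) :
    (torus m).StarEdgeColorable 6 := by
  refine starEdgeColorable_of_table
    -- Horizontal edges repeat 4, 5, 3, 0 along each column, shifted by one in the next. Vertical
    -- edges in even rows alternate between 1 and 2.
    [[2, 4, 1, 3, 2, 0], [1, 0, 2, 5, 1, 3], [2, 3, 1, 4, 2, 5], [1, 5, 2, 0, 1, 4]]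
    [[4, 5, 3, 0, 4, 5], [0, 4, 5, 3, 0, 4], [3, 0, 4, 5, 3, 0], [5, 3, 0, 4, 5, 3]]
    [(0, 1), (1, 2), (2, 3), (3, 0)] (by decide +kernel) (fun j => (j % 4).toNat) ?_ ?_
  · intro j
    congr 1
    omega
  · intro j
    simp only [List.mem_cons, Prod.mk.injEq, List.not_mem_nil, or_false]
    omega

/-- The possible successors of a column type. -/
def successors : List (ℕ × ℕ) :=
  [(0, 1), (1, 2), (2, 0), (2, 3), (3, 4), (4, 5), (5, 6), (6, 0), (2, 7), (7, 8), (8, 9),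
    (9, 10), (10, 11), (11, 0), (11, 7)]

/-- The column type at position `r` of a sequence which starts with `3 * a` columns of the types
`0, 1, 2` and goes on with the types `b, b + 1, …`. -/
def columnTypeAt (a b r : ℕ) : ℕ := if r < 3 * a then r % 3 else r - 3 * a + b

theorem columnTypeAt_mem_successors {n a b r : ℕ} (hr : r < n)
    (h : (n = 3 * a + 4 ∧ b = 3 ∧ 1 ≤ a) ∨ (n = 3 * a + 5 ∧ b = 7)) :
    (columnTypeAt a b r, columnTypeAt a b (if r + 1 = n then 0 else r + 1)) ∈ successors := by
  have step : ∀ x y, columnTypeAt a b r = x →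
      columnTypeAt a b (if r + 1 = n then 0 else r + 1) = y → (x, y) ∈ successors →
      (columnTypeAt a b r, columnTypeAt a b (if r + 1 = n then 0 else r + 1)) ∈ successors := by
    rintro x y rfl rfl h
    exact h
  by_cases hlast : r + 1 = n
  · rw [if_pos hlast] at step
    unfold columnTypeAt at step
    rw [if_pos hlast]
    unfold columnTypeAt
    rcases h with ⟨h1, h2, h3⟩ | ⟨h1, h2⟩
    · exact step 6 0 (by rw [if_neg (by omega)]; omega) (by rw [if_pos (by omega)]) (by decide)
    · rcases Nat.eq_zero_or_pos a with h3 | h3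
      · exact step 11 7 (by rw [if_neg (by omega)]; omega) (by rw [if_neg (by omega)]; omega)
          (by decide)
      · exact step 11 0 (by rw [if_neg (by omega)]; omega) (by rw [if_pos (by omega)]) (by decide)
  · rw [if_neg hlast] at step ⊢
    unfold columnTypeAt at step ⊢
    rcases lt_trichotomy (r + 1) (3 * a) with h3 | h3 | h3
    · rw [if_pos (by omega), if_pos h3] at step ⊢
      rcases (by omega : r % 3 = 0 ∨ r % 3 = 1 ∨ r % 3 = 2) with h4 | h4 | h4
      · exact step 0 1 h4 (by omega) (by decide)
      · exact step 1 2 h4 (by omega) (by decide)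
      · exact step 2 0 h4 (by omega) (by decide)
    · rw [if_pos (by omega), if_neg (by omega)] at step ⊢
      rcases h with ⟨h1, h2, h5⟩ | ⟨h1, h2⟩
      · exact step 2 3 (by omega) (by omega) (by decide)
      · exact step 2 7 (by omega) (by omega) (by decide)
    · rw [if_neg (by omega), if_neg (by omega)] at step ⊢
      obtain ⟨t, ht⟩ : ∃ t, r = 3 * a + t := ⟨r - 3 * a, by omega⟩
      have e1 : r - 3 * a = t := by omega
      have e2 : r + 1 - 3 * a = t + 1 := by omega
      rw [e1, e2]
      rcases h with ⟨h1, rfl, h5⟩ | ⟨h1, rfl⟩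
      · have : t < 3 := by omega
        interval_cases t <;> decide
      · have : t < 4 := by omega
        interval_cases t <;> decide

/-- Seven colors suffice if `m + 3` is not divisible by `3` or `4`. -/
theorem starEdgeColorable_seven {m : ℕ} (h3 : ¬ 3 ∣ m + 3) (h4 : ¬ 4 ∣ m + 3) :
    (torus m).StarEdgeColorable 7 := by
  obtain ⟨a, b, hab⟩ : ∃ a b, (m + 3 = 3 * a + 4 ∧ b = 3 ∧ 1 ≤ a) ∨ (m + 3 = 3 * a + 5 ∧ b = 7) := by
    rcases (by omega : m % 3 = 0 ∨ m % 3 = 1 ∨ m % 3 = 2) with h | h | h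
    · omega
    · refine ⟨(m - 1) / 3, 3, Or.inl ⟨by omega, rfl, ?_⟩⟩
      by_contra h0
      -- Without any copy of the three-column loop the torus would have four columns, a length
      -- divisible by 4.
      have : m = 1 := by omega
      subst this
      exact h4 (by norm_num)
    · exact ⟨(m - 2) / 3, 7, Or.inr ⟨by omega, rfl⟩⟩
  refine starEdgeColorable_of_table
    -- Types 0 to 2 form a loop of three columns; types 3 to 6 and 7 to 11 are detours of four and
    -- five columns returning to it. The second detour also closes up on itself, which covers length
    -- 5.
    [[6, 5, 0, 1, 5, 0], [0, 1, 3, 6, 4, 5], [5, 0, 1, 5, 0, 4], [4, 0, 6, 1, 6, 0],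
      [2, 1, 2, 4, 1, 5], [0, 2, 1, 0, 2, 6], [5, 0, 2, 6, 3, 4], [5, 6, 0, 1, 5, 0],
      [2, 1, 2, 0, 1, 3], [3, 0, 2, 3, 4, 0], [2, 0, 3, 2, 6, 3], [5, 0, 1, 6, 3, 4]]
    [[3, 2, 4, 5, 2, 6], [2, 4, 6, 2, 1, 3], [1, 3, 2, 4, 3, 2], [6, 5, 5, 0, 2, 3],
      [3, 4, 6, 3, 5, 0], [2, 1, 3, 5, 4, 1], [1, 3, 6, 4, 0, 2], [6, 4, 3, 5, 2, 6],
      [4, 6, 4, 6, 6, 5], [5, 1, 5, 1, 5, 2], [6, 4, 6, 4, 0, 1], [1, 3, 2, 3, 4, 2]]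
    successors (by decide +kernel) (fun j => columnTypeAt a b (j % (m + 3 : ℕ)).toNat) ?_ ?_
  · intro j
    rw [Int.add_emod_right]
  · intro j
    have hpos : (0 : ℤ) < (m + 3 : ℕ) := by omega
    obtain ⟨r, hr⟩ := Int.eq_ofNat_of_zero_le (Int.emod_nonneg j hpos.ne')
    have hlt := Int.emod_lt_of_pos j hpos
    have hnext : ((j + 1) % (m + 3 : ℕ)).toNat = if r + 1 = m + 3 then 0 else r + 1 := by
      rw [← Int.emod_add_emod, hr]
      split_ifs with h
      · have : ((r : ℤ) + 1) = (m + 3 : ℕ) := by exact_mod_cast h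
        rw [this, Int.emod_self]
        rfl
      · rw [Int.emod_eq_of_lt (by omega) (by omega)]
        omega
    rw [hnext, hr, Int.toNat_natCast]
    exact columnTypeAt_mem_successors (by omega) hab

/-! ### The star chromatic index -/

theorem starChromaticIndex_eq {V : Type*} {G : SimpleGraph V} {k : ℕ} (h : G.StarEdgeColorable k)
    (h' : ∀ l, G.StarEdgeColorable l → k ≤ l) : G.starChromaticIndex = k :=
  le_antisymm (iInf₂_le k h) (le_iInf₂ fun l hl => Nat.cast_le.2 (h' l hl))

end StarSearch

theorem mainTheorem6 (n : ℕ) (hn : 3 ≤ n) :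
    (SimpleGraph.boxProd (SimpleGraph.cycleGraph 6)
      (SimpleGraph.cycleGraph n)).starChromaticIndex =
      if n ≡ 0 [MOD 3] ∨ n ≡ 0 [MOD 4] then 6 else 7 := by
  obtain ⟨m, rfl⟩ := Nat.exists_eq_add_of_le' hn
  split_ifs with h <;> rw [Nat.modEq_zero_iff_dvd, Nat.modEq_zero_iff_dvd] at h
  · refine StarSearch.starChromaticIndex_eq (k := 6) ?_ fun l hl => ?_
    · exact h.elim StarSearch.starEdgeColorable_of_three_dvd
        StarSearch.starEdgeColorable_of_four_dvd
    · obtain ⟨c, hc⟩ := hl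
      exact StarSearch.six_le_of_star hc
  · rw [not_or] at h
    refine StarSearch.starChromaticIndex_eq (k := 7)
      (StarSearch.starEdgeColorable_seven h.1 h.2) fun l hl => ?_
    obtain ⟨c, hc⟩ := hl
    have h6 : 6 ≤ l := StarSearch.six_le_of_star (m := m) hc
    rcases Nat.eq_or_lt_of_le h6 with rfl | h7
    · exact absurd (StarSearch.dvd_of_star (m := m) hc) (not_or.2 h)
    · exact h7
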